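/- **Theorem (HyperAttention guarantee).** For $Q,K,V\in\mathbb R^{n\times d}$, $d\ge 1$, let $A=\exp(QK^\top)$ (entrywise), let $D$ be the diagonal matrix with $D_{i,i}=\|A_{i,:}\|_1$, and let $\mathbf{Att}=D^{-1}AV$. Let $M\in\{0,1\}^{n\times n}$ be a mask and write $u_i=\langle 1-M_{i,:},A_{i,:}\rangle$ and $b_i=\langle M_{i,:},A_{i,:}\rangle$. *Algorithm.* $\mathrm{HyperAttention}(Q,K,V,M,\kappa,\varepsilon,m_D,m_S)$, with an absolute constant $c>0$: 1. Choose a uniformly random $T\subseteq[n]$ with $|T|=\min(m_D,n)$, put $\tau=\max_{j\in T}u_j$, and draw $\ell_1,\dots,\ell_{m_D}$ i.i.d. uniformly from $[n]$. For every $i\in[n]$ let $C_i=c\,\frac{\varepsilon^2m_D}{n\log n}\left(b_i+\frac{\tau}{\kappa}\right)$, $\;d_i=\frac n{m_D}\sum_{j=1}^{m_D}(1-M_{i,\ell_j})\min(A_{i,\ell_j},C_i)$ and $\tilde d_i=b_i+\max\left(d_i,\frac\tau\kappa\right)$. Put $\widetilde D=\mathrm{diag}(\tilde d_1,\dots,\tilde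 d_n)$. 2. Draw $\ell'_1,\dots,\ell'_{m_S}$ i.i.d. from $[n]$ with probabilities $\|V_{i,:}\|_2^2/\|V\|_F^2$ (uniformly if $V=0$), and let the $r$-th row of $S\in\mathbb R^{m_S\times n}$ be $\frac{\|V\|_F}{\sqrt{m_S}\,\|V_{\ell'_r,:}\|_2}\,e^{(\ell'_r)}$ (zero if $V=0$). 3. Return $\widetilde D$ and $S$. *Statement.* There are absolute constants $c,C>0$ such that the following holds. For all sequences $e(n),a(n),k(n)\to0$ there is a sequence $s(n)\to0$ such that for every sequence $\delta(n)\to0$ there is a sequence $t(n)\to0$ such that for all sufficiently large $n$, all $d\ge1$, all $Q,K,V\in\mathbb R^{n\times d}$, all masks $M\in\{0,1\}^{n\times n}$ and all $\varepsilon$ with $n^{-e(n)}<\varepsilon\le1$: suppose that $$\max_{j\in[n]}\|D^{-1}A\,e^{(j)}\|_2^2\le\frac{n^{a(n)}}n\qquad\text{and}\qquad \max_{i\in[n]}u_i\le n^{k(n)}\min_{j\in[n]}u_j .$$ Run the algorithm with $\kappa=n^{k(n)}$, $m_S=\lceil d\,n^{s(n)}\rceil$, and either $m_D=\lceil d\,n^{s(n)}\rceil$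 or $m_D=\lceil n^{s(n)}\rceil$. Then with probability at least $0.98$ all $\tilde d_i$ are positive and $$\left\|\mathbf{Att}-\widetilde D^{-1}AS^\top S V\right\|_{op}\le\varepsilon\,\|D^{-1}A\|_{op}\,\|V\|_{op}.$$ Moreover, if $d\le n^{\delta(n)}$ or $m_D=\lceil n^{s(n)}\rceil$, then every run of the algorithm, carried out with naive matrix multiplication, takes at most $C\left(d\cdot n^{1+t(n)}+d\cdot\mathrm{nnz}(M)\right)$ steps. Steps are counted on a randomized real RAM with exact arithmetic: an arithmetic operation, minimum, maximum, $\exp$, $\log$, square root, memory access, bit test, loop increment or uniform random index costs one step; a draw from $n$ given weights, or a uniformly random subset of $[n]$ of given size, costs $n$ steps. The mask is stored sparsely (each row's list of nonzero positions can be traversed at unit cost per element, and a single entry can be tested in one step). -/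

import Mathlib

open scoped ENNReal Matrix
open Filter Topology

namespace HyperAttention

/-! ### Attention -/

/-- The spectral norm of a rectangular matrix, i.e. the operator norm of `x ↦ X x` between
Euclidean spaces. -/
noncomputable def opNorm {p q : ℕ} (X : Matrix (Fin p) (Fin q) ℝ) : ℝ :=
  ‖(Matrix.toEuclideanLin X).toContinuousLinearMap‖

/-- `A = exp(Q Kᵀ)`, the exponential being taken entrywise. -/
noncomputable def attnMatrix {n d : ℕ} (Q K : Matrix (Fin n) (Fin d) ℝ) :
    Matrix (Fin n) (Fin n) ℝ :=
  (Q * Kᵀ).map Real.exp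

/-- The diagonal matrix `D` with `D i i = ‖A i‖₁`. -/
noncomputable def rowSumMatrix {n : ℕ} (A : Matrix (Fin n) (Fin n) ℝ) :
    Matrix (Fin n) (Fin n) ℝ :=
  Matrix.diagonal fun i => ∑ j, |A i j|

/-- The softmax matrix `D⁻¹ A`. -/
noncomputable def softmaxMatrix {n d : ℕ} (Q K : Matrix (Fin n) (Fin d) ℝ) :
    Matrix (Fin n) (Fin n) ℝ :=
  (rowSumMatrix (attnMatrix Q K))⁻¹ * attnMatrix Q K

/-- `Att = D⁻¹ A V`. -/
noncomputable def attention {n d : ℕ} (Q K V : Matrix (Fin n) (Fin d) ℝ) :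
    Matrix (Fin n) (Fin d) ℝ :=
  softmaxMatrix Q K * V

/-- The row sum `⟨1 - M i, A i⟩` over the positions outside a 0/1 mask (`true` stands for 1). -/
noncomputable def unmaskedRowSum {n d : ℕ} (Q K : Matrix (Fin n) (Fin d) ℝ)
    (M : Matrix (Fin n) (Fin n) Bool) (i : Fin n) : ℝ :=
  ∑ j, (1 - if M i j then 1 else 0) * attnMatrix Q K i j

/-- The number of non-zero entries of a mask. -/
def nnz {n : ℕ} (M : Matrix (Fin n) (Fin n) Bool) : ℕ :=
  (Finset.univ.filter fun p : Fin n × Fin n => M p.1 p.2 = true).card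

/-! ### A randomized real RAM -/

/-- The instructions of a randomized real RAM, indexed by the type of the value they return. -/
inductive Instr : Type → Type
  /-- fetch a real number from memory -/
  | load (x : ℝ) : Instr ℝ
  /-- test a bit in memory -/
  | test (b : Bool) : Instr Bool
  /-- advance a loop counter or a list pointer -/
  | tick : Instr Unit
  | add (x y : ℝ) : Instr ℝ
  | sub (x y : ℝ) : Instr ℝ
  | mul (x y : ℝ) : Instr ℝ
  | div (x y : ℝ) : Instr ℝ
  | min (x y : ℝ) : Instr ℝ
  | max (x y : ℝ) : Instr ℝ
  | exp (x : ℝ) : Instr ℝ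
  | log (x : ℝ) : Instr ℝ
  | sqrt (x : ℝ) : Instr ℝ
  /-- a uniform index in `[n]` -/
  | unif (n : ℕ) [NeZero n] : Instr (Fin n)
  /-- an index in `[n]` drawn with probability proportional to the given weights -/
  | draw {n : ℕ} [NeZero n] (w : Fin n → ℝ) : Instr (Fin n)
  /-- a uniformly random subset of `[n]` of cardinality `min m n` -/
  | subset (n m : ℕ) : Instr (Finset (Fin n))

/-- The distribution on `[n]` proportional to the nonnegative weights `w`; the uniform one if all
weights vanish. -/
noncomputable def weightedPMF {n : ℕ} [NeZero n] (w : Fin n → ℝ) : PMF (Fin n) :=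
  if h : (∑' i, ENNReal.ofReal (w i)) ≠ 0 then
    PMF.normalize (fun i => ENNReal.ofReal (w i)) h
      (by rw [tsum_fintype]; exact ENNReal.sum_ne_top.2 fun i _ => ENNReal.ofReal_ne_top)
  else PMF.uniformOfFintype (Fin n)

theorem powersetCard_min_nonempty (n m : ℕ) :
    (Finset.powersetCard (min m n) (Finset.univ : Finset (Fin n))).Nonempty :=
  Finset.powersetCard_nonempty.2 (by simp)

/-- The law of the value returned by an instruction. -/
noncomputable def Instr.law : {β : Type} → Instr β → PMF β
  | _, .load x => PMF.pure x
  | _, .test b => PMF.pure b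
  | _, .tick => PMF.pure ()
  | _, .add x y => PMF.pure (x + y)
  | _, .sub x y => PMF.pure (x - y)
  | _, .mul x y => PMF.pure (x * y)
  | _, .div x y => PMF.pure (x / y)
  | _, .min x y => PMF.pure (Min.min x y)
  | _, .max x y => PMF.pure (Max.max x y)
  | _, .exp x => PMF.pure (Real.exp x)
  | _, .log x => PMF.pure (Real.log x)
  | _, .sqrt x => PMF.pure (Real.sqrt x)
  | _, @Instr.unif n _ => PMF.uniformOfFintype (Fin n)
  | _, @Instr.draw _ _ w => weightedPMF w
  | _, .subset n m => PMF.uniformOfFinset _ (powersetCard_min_nonempty n m)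

/-- The number of steps of an instruction: one, except that a weighted draw and a random subset
are charged one step per element of the ground set. -/
def Instr.cost : {β : Type} → Instr β → ℕ
  | _, @Instr.draw n _ _ => n
  | _, .subset n _ => n
  | _, _ => 1

/-- Programs returning a value of type `α`. -/
inductive Prog (α : Type) : Type 1
  | ret (a : α) : Prog α
  | step {β : Type} (i : Instr β) (k : β → Prog α) : Prog α

namespace Prog

def bind {α γ : Type} : Prog α → (α → Prog γ) → Prog γ
  | ret a, f => f a
  | step i k, f => step i fun b => (k b).bind f

instance : Monad Prog where
  pure := ret
  bind := bind

/-- A single instruction as a program. -/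
def exec {β : Type} (i : Instr β) : Prog β := step i ret

/-- The joint law of the returned value and of the number of executed steps. -/
noncomputable def run {α : Type} : Prog α → PMF (α × ℕ)
  | ret a => PMF.pure (a, 0)
  | step i k => i.law.bind fun b => (k b).run.map fun r => (r.1, r.2 + i.cost)

/-- Evaluate `f` along a list and add up the results. -/
def sumOver {ι : Type} (f : ι → Prog ℝ) : List ι → Prog ℝ
  | [] => pure 0
  | i :: l => do
    exec .tick
    let x ← f i
    let s ← sumOver f l
    exec (.add x s)

/-- Evaluate `f` along a list and take the maximum of `0` and the results. -/
def maxOver {ι : Type} (f : ι → Prog ℝ) : List ι → Prog ℝ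
  | [] => pure 0
  | i :: l => do
    exec .tick
    let x ← f i
    let s ← maxOver f l
    exec (.max x s)

/-- Evaluate `f 0, …, f (n - 1)` one after the other and store the results in an array. -/
def tabulate {α : Type} : (n : ℕ) → (Fin n → Prog α) → Prog (Fin n → α)
  | 0, _ => pure Fin.elim0
  | n + 1, f => do
    exec .tick
    let x ← f 0
    let xs ← tabulate n fun i => f i.succ
    pure (Fin.cons x xs)

end Prog

open Prog

/-! ### The algorithms

The input matrices `Q, K, V` are stored as arrays. The mask is stored sparsely: the list of the
non-zero positions of a row can be traversed at one step per element, and a single bit can be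
tested in one step. -/

/-- Compute `⟨x, y⟩`. -/
def dot {d : ℕ} (x y : Fin d → ℝ) : Prog ℝ :=
  sumOver (fun t => do
    let a ← exec (.load (x t))
    let b ← exec (.load (y t))
    exec (.mul a b)) (List.finRange d)

/-- Compute `exp ⟨Q i, K j⟩`. -/
def entry {n d : ℕ} (Q K : Matrix (Fin n) (Fin d) ℝ) (i j : Fin n) : Prog ℝ := do
  let s ← dot (Q i) (K j)
  exec (.exp s)

/-- The list of the non-zero positions of row `i` of the mask. -/
def maskRow {n : ℕ} (M : Matrix (Fin n) (Fin n) Bool) (i : Fin n) : List (Fin n) :=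
  (List.finRange n).filter fun j => M i j

/-- Compute `⟨M i, exp(K (Q i)ᵀ)⟩`. -/
def maskedSum {n d : ℕ} (Q K : Matrix (Fin n) (Fin d) ℝ) (M : Matrix (Fin n) (Fin n) Bool)
    (i : Fin n) : Prog ℝ :=
  sumOver (entry Q K i) (maskRow M i)

/-- Compute `⟨1 - M i, exp(K (Q i)ᵀ)⟩`. -/
def unmaskedSum {n d : ℕ} (Q K : Matrix (Fin n) (Fin d) ℝ) (M : Matrix (Fin n) (Fin n) Bool)
    (i : Fin n) : Prog ℝ :=
  sumOver (fun j => do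
    let b ← exec (.test (M i j))
    if b then pure 0 else entry Q K i j) (List.finRange n)

/-- `ApproxD`: estimate the diagonal of `D`. The constant `c` is the one hidden in
`C i ← Θ(ε² m / (n log n) · (⟨M i, exp(K (Q i)ᵀ)⟩ + τ / κ))`. -/
noncomputable def approxD {n d : ℕ} [NeZero n] (c : ℝ) (Q K : Matrix (Fin n) (Fin d) ℝ)
    (M : Matrix (Fin n) (Fin n) Bool) (κ ε : ℝ) (m : ℕ) : Prog (Fin n → ℝ) := do
  let T ← exec (.subset n m)
  let τ ← maxOver (unmaskedSum Q K M) (T.sort (· ≤ ·))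
  let τκ ← exec (.div τ κ)
  let l ← tabulate m fun _ => exec (.unif n)
  let L ← exec (.log n)
  let nL ← exec (.mul n L)
  let ε2 ← exec (.mul ε ε)
  let ε2m ← exec (.mul ε2 m)
  let q ← exec (.div ε2m nL)
  let cq ← exec (.mul c q)
  let nm ← exec (.div n m)
  tabulate n fun i => do
    let b ← maskedSum Q K M i
    let bτ ← exec (.add b τκ)
    let Ci ← exec (.mul cq bτ)
    let s ← sumOver (fun j => do
      let z ← exec (.test (M i (l j)))
      if z then pure 0 else do
        let a ← entry Q K i (l j)
        exec (.min a Ci)) (List.finRange m)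
    let di ← exec (.mul nm s)
    let ei ← exec (.max di τκ)
    exec (.add b ei)

/-- Compute the rows of an i.i.d. sampling matrix based on the squared row norms of `V`: draw
`ℓ r` with probability `‖V (ℓ r)‖² / ‖V‖_F²`, and return it together with the coefficient
`‖V‖_F / (√m ‖V (ℓ r)‖)`, for each of the `m` rows `r`. -/
noncomputable def rowNormSample {n d : ℕ} [NeZero n] (V : Matrix (Fin n) (Fin d) ℝ) (m : ℕ) :
    Prog (Fin m → Fin n × ℝ) := do
  let w ← tabulate n fun i => dot (V i) (V i)
  let F2 ← sumOver (fun i => exec (.load (w i))) (List.finRange n)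
  let F ← exec (.sqrt F2)
  let sm ← exec (.sqrt m)
  tabulate m fun _ => do
    let l ← exec (.draw w)
    let v ← exec (.sqrt (w l))
    let p ← exec (.mul sm v)
    let x ← exec (.div F p)
    pure (l, x)

/-- The `m × n` matrix whose row `r` is `x r • e_(ℓ r)`, where `S r = (ℓ r, x r)`. -/
def samplingMatrix {m n : ℕ} (S : Fin m → Fin n × ℝ) : Matrix (Fin m) (Fin n) ℝ :=
  Matrix.of fun r => Pi.single (S r).1 (S r).2

/-- `HyperAttention`: run `ApproxD` with sample size `mD`, and sample `mS` rows according to the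
squared row norms of `V`. The output is the diagonal of `D̃` and the sparse rows of `S`. -/
noncomputable def hyperAttention {n d : ℕ} [NeZero n] (c : ℝ) (Q K V : Matrix (Fin n) (Fin d) ℝ)
    (M : Matrix (Fin n) (Fin n) Bool) (κ ε : ℝ) (mD mS : ℕ) :
    Prog ((Fin n → ℝ) × (Fin mS → Fin n × ℝ)) := do
  let D' ← approxD c Q K M κ ε mD
  let S ← rowNormSample V mS
  pure (D', S)

/-- The spectral guarantee `‖Att - D̃⁻¹ A Sᵀ S V‖ ≤ ε ‖D⁻¹ A‖ ‖V‖`, where `D̃` is the diagonal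
matrix with entries `D'`, which are required to be positive. -/
def SpectralGuarantee {n d m : ℕ} (Q K V : Matrix (Fin n) (Fin d) ℝ) (ε : ℝ) (D' : Fin n → ℝ)
    (S : Matrix (Fin m) (Fin n) ℝ) : Prop :=
  (∀ i, 0 < D' i) ∧
    opNorm (attention Q K V - (Matrix.diagonal D')⁻¹ * attnMatrix Q K * Sᵀ * (S * V)) ≤
      ε * opNorm (softmaxMatrix Q K) * opNorm V

end HyperAttention

namespace HyperAttention

/-! ### Expectations over finite types -/

/-- The expectation of a real function on a finite type. -/
noncomputable def expect {α : Type} [Fintype α] (μ : PMF α) (f : α → ℝ) : ℝ :=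
  ∑ a, (μ a).toReal * f a

section expect

variable {α γ : Type} [Fintype α] [Fintype γ]

theorem sum_toReal_pmf (μ : PMF α) : ∑ a, (μ a).toReal = 1 := by
  rw [← ENNReal.toReal_sum fun a _ => μ.apply_ne_top a, ← tsum_fintype (L := .unconditional _),
    μ.tsum_coe, ENNReal.toReal_one]

theorem expect_const (μ : PMF α) (x : ℝ) : expect μ (fun _ => x) = x := by
  rw [expect, ← Finset.sum_mul, sum_toReal_pmf, one_mul]

theorem expect_add (μ : PMF α) (f g : α → ℝ) :
    expect μ (fun a => f a + g a) = expect μ f + expect μ g := by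
  simp only [expect, mul_add, Finset.sum_add_distrib]

theorem expect_sub (μ : PMF α) (f g : α → ℝ) :
    expect μ (fun a => f a - g a) = expect μ f - expect μ g := by
  simp only [expect, mul_sub, Finset.sum_sub_distrib]

theorem expect_const_mul (μ : PMF α) (x : ℝ) (f : α → ℝ) :
    expect μ (fun a => x * f a) = x * expect μ f := by
  simp only [expect, Finset.mul_sum]
  exact Finset.sum_congr rfl fun a _ => by ring

theorem expect_sum {ι : Type} (s : Finset ι) (μ : PMF α) (f : ι → α → ℝ) :
    expect μ (fun a => ∑ i ∈ s, f i a) = ∑ i ∈ s, expect μ (f i) := by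
  simp only [expect, Finset.mul_sum]
  exact Finset.sum_comm

theorem expect_mono (μ : PMF α) {f g : α → ℝ} (h : ∀ a, f a ≤ g a) : expect μ f ≤ expect μ g :=
  Finset.sum_le_sum fun a _ => mul_le_mul_of_nonneg_left (h a) ENNReal.toReal_nonneg

theorem expect_bind (μ : PMF α) (ν : α → PMF γ) (f : γ → ℝ) :
    expect (μ.bind ν) f = expect μ fun a => expect (ν a) f := by
  have h (c : γ) : ((μ.bind ν) c).toReal = ∑ a, (μ a).toReal * (ν a c).toReal := by
    rw [PMF.bind_apply, tsum_fintype, ENNReal.toReal_sum fun a _ =>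
      ENNReal.mul_ne_top (μ.apply_ne_top a) ((ν a).apply_ne_top c)]
    simp only [ENNReal.toReal_mul]
  simp only [expect, h, Finset.sum_mul, Finset.mul_sum]
  rw [Finset.sum_comm]
  exact Finset.sum_congr rfl fun a _ => Finset.sum_congr rfl fun c _ => by ring

theorem expect_pure (a : α) (f : α → ℝ) : expect (PMF.pure a) f = f a := by
  classical
  rw [expect, Finset.sum_eq_single a]
  · simp
  · intro b _ hb
    simp [PMF.pure_apply, hb]
  · simp

theorem expect_map (μ : PMF α) (g : α → γ) (f : γ → ℝ) :
    expect (μ.map g) f = expect μ fun a => f (g a) := by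
  rw [← PMF.bind_pure_comp, expect_bind]
  simp only [Function.comp, expect_pure]

theorem expect_uniform {n : ℕ} [NeZero n] (f : Fin n → ℝ) :
    expect (PMF.uniformOfFintype (Fin n)) f = (∑ i, f i) / n := by
  simp only [expect, PMF.uniformOfFintype_apply, Fintype.card_fin, ENNReal.toReal_inv,
    ENNReal.toReal_natCast]
  rw [← Finset.mul_sum, div_eq_inv_mul]

/-- The probability of an event, as the expectation of its indicator function. -/
theorem toOuterMeasure_eq_expect (μ : PMF α) (s : Set α) [DecidablePred (· ∈ s)] :
    μ.toOuterMeasure s = ENNReal.ofReal (expect μ fun a => if a ∈ s then 1 else 0) := by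
  rw [PMF.toOuterMeasure_apply_fintype, expect,
    ENNReal.ofReal_sum_of_nonneg fun a _ => by positivity]
  refine Finset.sum_congr rfl fun a _ => ?_
  by_cases h : a ∈ s
  · simp [h, ENNReal.ofReal_toReal (μ.apply_ne_top a)]
  · simp [h]

end expect

theorem le_toOuterMeasure_bind {α γ : Type} (μ : PMF α) (ν : α → PMF γ) (s : Set γ) (x : ℝ≥0∞)
    (h : ∀ a ∈ μ.support, x ≤ (ν a).toOuterMeasure s) : x ≤ (μ.bind ν).toOuterMeasure s := by
  rw [PMF.toOuterMeasure_bind_apply]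
  calc x = ∑' a, μ a * x := by rw [ENNReal.tsum_mul_right, μ.tsum_coe, one_mul]
    _ ≤ _ := by
      refine ENNReal.tsum_le_tsum fun a => ?_
      by_cases ha : μ a = 0
      · simp [ha]
      · exact mul_le_mul_right (h a ((μ.mem_support_iff a).2 ha)) _

/-! ### Independent samples -/

/-- The law of `m` independent samples from `μ`. -/
noncomputable def iid {α : Type} (μ : PMF α) : (m : ℕ) → PMF (Fin m → α)
  | 0 => PMF.pure Fin.elim0
  | m + 1 => μ.bind fun x => (iid μ m).map (Fin.cons x)

section iid

variable {α : Type} [Fintype α]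

theorem expect_iid_succ (μ : PMF α) (m : ℕ) (f : (Fin (m + 1) → α) → ℝ) :
    expect (iid μ (m + 1)) f = expect μ fun x => expect (iid μ m) fun l => f (Fin.cons x l) := by
  rw [iid, expect_bind]
  simp only [expect_map]

theorem expect_iid_sum (μ : PMF α) (m : ℕ) (y : α → ℝ) :
    expect (iid μ m) (fun l => ∑ r, y (l r)) = m * expect μ y := by
  induction m with
  | zero => simp [expect]
  | succ m ih =>
    rw [expect_iid_succ]
    simp only [Fin.sum_univ_succ, Fin.cons_zero, Fin.cons_succ, expect_add, expect_const, ih]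
    push_cast
    ring

theorem expect_iid_sq_sum (μ : PMF α) (m : ℕ) (y : α → ℝ) (h : expect μ y = 0) :
    expect (iid μ m) (fun l => (∑ r, y (l r)) ^ 2) = m * expect μ fun x => y x ^ 2 := by
  induction m with
  | zero => simp [expect]
  | succ m ih =>
    rw [expect_iid_succ]
    simp only [Fin.sum_univ_succ, Fin.cons_zero, Fin.cons_succ, add_sq, expect_add, expect_const,
      ih, expect_const_mul, expect_iid_sum, h, mul_zero]
    push_cast
    ring

/-- The variance of an average of independent samples is at most `E y² / m`. -/
theorem expect_iid_sq_mean_sub_le (μ : PMF α) {m : ℕ} (hm : 0 < m) (y : α → ℝ) :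
    expect (iid μ m) (fun l => ((∑ r, y (l r)) / m - expect μ y) ^ 2) ≤
      expect μ (fun x => y x ^ 2) / m := by
  have hm' : (0 : ℝ) < m := by exact_mod_cast hm
  set z : α → ℝ := fun x => y x - expect μ y with hz
  have hz0 : expect μ z = 0 := by rw [hz, expect_sub, expect_const, sub_self]
  have h1 : (fun l : Fin m → α => ((∑ r, y (l r)) / m - expect μ y) ^ 2) =
      fun l => ((m : ℝ) ^ 2)⁻¹ * (∑ r, z (l r)) ^ 2 := by
    funext l
    simp only [hz, Finset.sum_sub_distrib, Finset.sum_const, Finset.card_univ, Fintype.card_fin,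
      nsmul_eq_mul]
    field_simp
  have h2 : expect μ (fun x => z x ^ 2) ≤ expect μ fun x => y x ^ 2 := by
    have : (fun x => z x ^ 2) = fun x => (y x ^ 2 - (2 * expect μ y) * y x) + expect μ y ^ 2 := by
      funext x
      simp only [hz]
      ring
    rw [this, expect_add, expect_sub, expect_const, expect_const_mul]
    nlinarith [sq_nonneg (expect μ y)]
  rw [h1, expect_const_mul, expect_iid_sq_sum μ m z hz0]
  calc _ = expect μ (fun x => z x ^ 2) / m := by field_simp
    _ ≤ _ := by gcongr

end iid

/-! ### The law of the value of a program -/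

namespace Prog

variable {α γ : Type}

theorem run_bind (p : Prog α) (f : α → Prog γ) :
    (p >>= f).run = p.run.bind fun r => (f r.1).run.map fun q => (q.1, q.2 + r.2) := by
  change (p.bind f).run = _
  induction p with
  | ret a =>
    simp only [Prog.bind, run, PMF.pure_bind]
    exact (PMF.map_id _).symm
  | step i k ih =>
    simp only [Prog.bind, run, ih, PMF.bind_bind, PMF.map_bind, PMF.bind_map, PMF.map_comp,
      Function.comp_def, Nat.add_assoc]

/-- The law of the value returned by a program. -/
noncomputable def val (p : Prog α) : PMF α := p.run.map Prod.fst

theorem run_toOuterMeasure (p : Prog α) (s : Set α) :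
    p.run.toOuterMeasure {r | r.1 ∈ s} = p.val.toOuterMeasure s := by
  rw [val, PMF.toOuterMeasure_map_apply]
  rfl

@[simp]
theorem val_pure (a : α) : (pure a : Prog α).val = PMF.pure a := by
  change PMF.map Prod.fst (PMF.pure (a, 0)) = _
  rw [PMF.pure_map]

@[simp]
theorem val_bind (p : Prog α) (f : α → Prog γ) :
    (p >>= f).val = p.val.bind fun a => (f a).val := by
  simp only [val, run_bind, PMF.map_bind, PMF.bind_map, PMF.map_comp, Function.comp_def]

@[simp]
theorem val_exec (i : Instr α) : (exec i).val = i.law := by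
  simp [val, exec, run, PMF.map_bind, PMF.pure_map]

theorem val_sumOver {ι : Type} {f : ι → Prog ℝ} {g : ι → ℝ} (h : ∀ i, (f i).val = PMF.pure (g i))
    (l : List ι) : (sumOver f l).val = PMF.pure (l.map g).sum := by
  induction l with
  | nil => simp [sumOver]
  | cons i l ih => simp [sumOver, h, ih, Instr.law, PMF.pure_bind]

theorem val_maxOver {ι : Type} {f : ι → Prog ℝ} {g : ι → ℝ} (h : ∀ i, (f i).val = PMF.pure (g i))
    (l : List ι) : (maxOver f l).val = PMF.pure ((l.map g).foldr max 0) := by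
  induction l with
  | nil => simp [maxOver]
  | cons i l ih => simp [maxOver, h, ih, Instr.law, PMF.pure_bind]

theorem val_tabulate_pure : ∀ {n : ℕ} {f : Fin n → Prog α} {g : Fin n → α},
    (∀ i, (f i).val = PMF.pure (g i)) → (tabulate n f).val = PMF.pure g
  | 0, _, _, _ => by
    rw [tabulate, val_pure]
    exact congrArg _ (Subsingleton.elim _ _)
  | n + 1, f, g, h => by
    simp only [tabulate, val_bind, val_exec, Instr.law, PMF.pure_bind, h, val_pure,
      val_tabulate_pure (f := fun i => f i.succ) fun i => h i.succ]
    exact congrArg _ (Fin.cons_self_tail g)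

theorem val_tabulate_map {p : Prog α} {μ : PMF γ} {g : γ → α} (h : p.val = μ.map g) (m : ℕ) :
    (tabulate m fun _ => p).val = (iid μ m).map fun l r => g (l r) := by
  induction m with
  | zero =>
    rw [tabulate, val_pure, iid, PMF.pure_map]
    exact congrArg _ (Subsingleton.elim _ _)
  | succ m ih =>
    simp only [tabulate, val_bind, val_exec, Instr.law, PMF.pure_bind, h, val_pure, ih, iid,
      PMF.bind_map, PMF.map_bind, PMF.map_comp, Function.comp_def]
    congr 1
    funext x
    rw [← PMF.bind_pure_comp]
    congr 1
    funext l
    refine congrArg _ (funext fun r => ?_)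
    refine Fin.cases ?_ (fun r => ?_) r <;> simp

/-! ### Bounds for the number of steps -/

/-- Every execution of the program takes at most `N` steps. -/
def CostLE (p : Prog α) (N : ℕ) : Prop := ∀ r ∈ p.run.support, r.2 ≤ N

theorem CostLE.mono {p : Prog α} {N N' : ℕ} (h : p.CostLE N) (hN : N ≤ N') : p.CostLE N' :=
  fun r hr => (h r hr).trans hN

theorem costLE_pure (a : α) : (pure a : Prog α).CostLE 0 := by
  intro r hr
  have : r = (a, 0) := (PMF.mem_support_pure_iff _ _).1 hr
  simp [this]

theorem CostLE.bind_of_support {p : Prog α} {f : α → Prog γ} {N N' : ℕ} (hp : p.CostLE N)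
    (hf : ∀ a ∈ p.val.support, (f a).CostLE N') : (p >>= f).CostLE (N + N') := by
  intro r hr
  rw [run_bind, PMF.mem_support_bind_iff] at hr
  obtain ⟨q, hq, hr⟩ := hr
  obtain ⟨q', hq', rfl⟩ := (PMF.mem_support_map_iff _ _ _).1 hr
  have h1 := hp q hq
  have h2 := hf q.1 ((PMF.mem_support_map_iff _ _ _).2 ⟨q, hq, rfl⟩) q' hq'
  simp only
  omega

theorem CostLE.bind {p : Prog α} {f : α → Prog γ} {N N' : ℕ} (hp : p.CostLE N)
    (hf : ∀ a, (f a).CostLE N') : (p >>= f).CostLE (N + N') :=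
  hp.bind_of_support fun a _ => hf a

theorem costLE_exec (i : Instr α) : (exec i).CostLE i.cost := by
  intro r hr
  simp only [exec, run, PMF.pure_map] at hr
  obtain ⟨b, _, hr⟩ := (PMF.mem_support_bind_iff _ _ _).1 hr
  rw [(PMF.mem_support_pure_iff _ _).1 hr]
  simp

theorem costLE_sumOver {ι : Type} {f : ι → Prog ℝ} {N : ℕ} (h : ∀ i, (f i).CostLE N)
    (l : List ι) : (sumOver f l).CostLE (l.length * (N + 2)) := by
  induction l with
  | nil => exact (costLE_pure _).mono (Nat.zero_le _)
  | cons i l ih =>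
    rw [sumOver]
    refine CostLE.mono (N := 1 + (N + (l.length * (N + 2) + 1))) ?_
      (by rw [List.length_cons]; linarith)
    exact (costLE_exec .tick).bind fun _ => (h i).bind fun _ => ih.bind fun _ => costLE_exec _

theorem costLE_maxOver {ι : Type} {f : ι → Prog ℝ} {N : ℕ} (h : ∀ i, (f i).CostLE N)
    (l : List ι) : (maxOver f l).CostLE (l.length * (N + 2)) := by
  induction l with
  | nil => exact (costLE_pure _).mono (Nat.zero_le _)
  | cons i l ih =>
    rw [maxOver]
    refine CostLE.mono (N := 1 + (N + (l.length * (N + 2) + 1))) ?_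
      (by rw [List.length_cons]; linarith)
    exact (costLE_exec .tick).bind fun _ => (h i).bind fun _ => ih.bind fun _ => costLE_exec _

theorem costLE_tabulate : ∀ {n : ℕ} {f : Fin n → Prog α} {N : Fin n → ℕ},
    (∀ i, (f i).CostLE (N i)) → (tabulate n f).CostLE (∑ i, (N i + 1))
  | 0, _, _, _ => (costLE_pure _).mono (Nat.zero_le _)
  | n + 1, f, N, h =>
    ((costLE_exec _).bind fun _ => (h 0).bind fun _ =>
      (costLE_tabulate fun i => h i.succ).bind fun _ => costLE_pure _).mono
        (by rw [Fin.sum_univ_succ]; simp only [Instr.cost]; omega)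

end Prog
/-! ### Spectral and Frobenius norms -/

section norms

variable {p q r : ℕ}

theorem opNorm_nonneg (X : Matrix (Fin p) (Fin q) ℝ) : 0 ≤ opNorm X := norm_nonneg _

theorem sum_sq_mulVec_le (X : Matrix (Fin p) (Fin q) ℝ) (x : Fin q → ℝ) :
    ∑ i, (X *ᵥ x) i ^ 2 ≤ opNorm X ^ 2 * ∑ j, x j ^ 2 := by
  have h := (Matrix.toEuclideanLin X).toContinuousLinearMap.le_opNorm (WithLp.toLp 2 x)
  have h2 := pow_le_pow_left₀ (norm_nonneg _) h 2
  rw [mul_pow, EuclideanSpace.real_norm_sq_eq, EuclideanSpace.real_norm_sq_eq] at h2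
  exact h2

theorem opNorm_le {X : Matrix (Fin p) (Fin q) ℝ} {c : ℝ} (hc : 0 ≤ c)
    (h : ∀ x : Fin q → ℝ, ∑ i, (X *ᵥ x) i ^ 2 ≤ c ^ 2 * ∑ j, x j ^ 2) : opNorm X ≤ c := by
  refine ContinuousLinearMap.opNorm_le_bound _ hc fun x => ?_
  refine le_of_sq_le_sq ?_ (by positivity)
  rw [mul_pow, EuclideanSpace.real_norm_sq_eq, EuclideanSpace.real_norm_sq_eq]
  exact h x

theorem opNorm_add_le (X Y : Matrix (Fin p) (Fin q) ℝ) :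
    opNorm (X + Y) ≤ opNorm X + opNorm Y := by
  simp only [opNorm, map_add]
  exact norm_add_le _ _

theorem opNorm_mul_le (X : Matrix (Fin p) (Fin q) ℝ) (Y : Matrix (Fin q) (Fin r) ℝ) :
    opNorm (X * Y) ≤ opNorm X * opNorm Y := by
  refine opNorm_le (mul_nonneg (opNorm_nonneg X) (opNorm_nonneg Y)) fun x => ?_
  rw [← Matrix.mulVec_mulVec, mul_pow, mul_assoc]
  exact (sum_sq_mulVec_le X _).trans
    (mul_le_mul_of_nonneg_left (sum_sq_mulVec_le Y x) (sq_nonneg _))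

theorem opNorm_le_of_sum_sq_le {X : Matrix (Fin p) (Fin q) ℝ} {c : ℝ} (hc : 0 ≤ c)
    (h : ∑ i, ∑ j, X i j ^ 2 ≤ c ^ 2) : opNorm X ≤ c := by
  refine opNorm_le hc fun x => ?_
  calc ∑ i, (X *ᵥ x) i ^ 2 ≤ ∑ i, (∑ j, X i j ^ 2) * ∑ j, x j ^ 2 :=
        Finset.sum_le_sum fun i _ => Finset.sum_mul_sq_le_sq_mul_sq Finset.univ (X i) x
    _ = (∑ i, ∑ j, X i j ^ 2) * ∑ j, x j ^ 2 := (Finset.sum_mul _ _ _).symm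
    _ ≤ _ := by gcongr

theorem sum_sq_le_opNorm (X : Matrix (Fin p) (Fin q) ℝ) :
    ∑ i, ∑ j, X i j ^ 2 ≤ q * opNorm X ^ 2 := by
  have h (j : Fin q) : ∑ i, X i j ^ 2 ≤ opNorm X ^ 2 := by
    simpa [Pi.single_apply, ite_pow] using sum_sq_mulVec_le X (Pi.single j 1)
  rw [Finset.sum_comm]
  exact (Finset.sum_le_sum fun j _ => h j).trans_eq (by simp)

theorem one_le_opNorm_of_row_sum_eq_one [NeZero p] {X : Matrix (Fin p) (Fin p) ℝ}
    (h : ∀ i, ∑ j, X i j = 1) : 1 ≤ opNorm X := by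
  have h1 := sum_sq_mulVec_le X fun _ => 1
  have hp : (0 : ℝ) < p := by exact_mod_cast Nat.pos_of_ne_zero (NeZero.ne p)
  simp only [Matrix.mulVec, dotProduct, mul_one, h, one_pow, Finset.sum_const, Finset.card_univ,
    Fintype.card_fin, nsmul_eq_mul] at h1
  have h2 : 1 ≤ opNorm X ^ 2 := by
    by_contra hlt
    nlinarith
  nlinarith [opNorm_nonneg X]

/-- Few rows of a stochastic matrix with small columns have a small spectral norm. -/
theorem sum_sq_mulVec_subset_le {X : Matrix (Fin p) (Fin q) ℝ} (h0 : ∀ i j, 0 ≤ X i j)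
    (h1 : ∀ i, ∑ j, X i j = 1) {γ : ℝ} (hγ : ∀ j, ∑ i, X i j ^ 2 ≤ γ) (B : Finset (Fin p))
    (x : Fin q → ℝ) :
    ∑ i ∈ B, (X *ᵥ x) i ^ 2 ≤ √(B.card * γ) * ∑ j, x j ^ 2 := by
  have hrow (i : Fin p) : (X *ᵥ x) i ^ 2 ≤ ∑ j, X i j * x j ^ 2 := by
    have h := Finset.sum_mul_sq_le_sq_mul_sq Finset.univ (fun j => √(X i j))
      fun j => √(X i j) * x j
    simp only [mul_pow, Real.sq_sqrt (h0 i _), h1, one_mul, ← mul_assoc,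
      Real.mul_self_sqrt (h0 i _)] at h
    exact h
  have hcol (j : Fin q) : ∑ i ∈ B, X i j ≤ √(B.card * γ) := by
    refine Real.le_sqrt_of_sq_le (sq_sum_le_card_mul_sum_sq.trans ?_)
    refine mul_le_mul_of_nonneg_left (le_trans ?_ (hγ j)) (Nat.cast_nonneg _)
    exact Finset.sum_le_sum_of_subset_of_nonneg (Finset.subset_univ _) fun i _ _ => sq_nonneg _
  calc ∑ i ∈ B, (X *ᵥ x) i ^ 2 ≤ ∑ i ∈ B, ∑ j, X i j * x j ^ 2 :=
        Finset.sum_le_sum fun i _ => hrow i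
    _ = ∑ j, (∑ i ∈ B, X i j) * x j ^ 2 := by
        rw [Finset.sum_comm]
        simp only [Finset.sum_mul]
    _ ≤ ∑ j, √(B.card * γ) * x j ^ 2 :=
        Finset.sum_le_sum fun j _ => mul_le_mul_of_nonneg_right (hcol j) (sq_nonneg _)
    _ = _ := (Finset.mul_sum _ _ _).symm

/-- Rescaling the rows of a stochastic matrix by factors which are close to one outside a small
set of rows and bounded on it. -/
theorem opNorm_rescale_sub_le [NeZero p] {X : Matrix (Fin p) (Fin p) ℝ} (h0 : ∀ i j, 0 ≤ X i j)
    (h1 : ∀ i, ∑ j, X i j = 1) {γ ε R : ℝ} (hγ : ∀ j, ∑ i, X i j ^ 2 ≤ γ) (hε : 0 ≤ ε)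
    {v : Fin p → ℝ} (hv : ∀ i, |1 - v i| ≤ R) {B : Finset (Fin p)}
    (hB : ∀ i ∉ B, |1 - v i| ≤ ε / 4) (hBγ : R ^ 2 * √(B.card * γ) ≤ ε ^ 2 / 8) :
    opNorm ((1 - Matrix.diagonal v) * X) ≤ ε / 2 * opNorm X := by
  have hX := one_le_opNorm_of_row_sum_eq_one h1
  refine opNorm_le (by positivity) fun x => ?_
  have hmul (i : Fin p) : (((1 - Matrix.diagonal v) * X) *ᵥ x) i = (1 - v i) * (X *ᵥ x) i := by
    rw [← Matrix.mulVec_mulVec, Matrix.sub_mulVec, Matrix.one_mulVec, Pi.sub_apply,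
      Matrix.mulVec_diagonal]
    ring
  have hi (i : Fin p) : (1 - v i) ^ 2 * (X *ᵥ x) i ^ 2 ≤
      (ε / 4) ^ 2 * (X *ᵥ x) i ^ 2 + if i ∈ B then R ^ 2 * (X *ᵥ x) i ^ 2 else 0 := by
    have hnn := sq_nonneg ((X *ᵥ x) i)
    split_ifs with hiB
    · have := sq_le_sq' (abs_le.1 (hv i)).1 (abs_le.1 (hv i)).2
      nlinarith [mul_nonneg (sq_nonneg (ε / 4)) hnn]
    · have := sq_le_sq' (abs_le.1 (hB i hiB)).1 (abs_le.1 (hB i hiB)).2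
      nlinarith
  simp only [hmul, mul_pow]
  have hx : 0 ≤ ∑ j, x j ^ 2 := Finset.sum_nonneg fun j _ => sq_nonneg _
  calc ∑ i, (1 - v i) ^ 2 * (X *ᵥ x) i ^ 2
      ≤ (ε / 4) ^ 2 * ∑ i, (X *ᵥ x) i ^ 2 + R ^ 2 * ∑ i ∈ B, (X *ᵥ x) i ^ 2 := by
        refine (Finset.sum_le_sum fun i _ => hi i).trans_eq ?_
        rw [Finset.sum_add_distrib, Finset.mul_sum, Finset.mul_sum, Finset.sum_ite_mem,
          Finset.univ_inter]
    _ ≤ (ε / 4) ^ 2 * (opNorm X ^ 2 * ∑ j, x j ^ 2) + ε ^ 2 / 8 * ∑ j, x j ^ 2 := by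
        gcongr ?_ + ?_
        · exact mul_le_mul_of_nonneg_left (sum_sq_mulVec_le X x) (sq_nonneg _)
        · refine (mul_le_mul_of_nonneg_left (sum_sq_mulVec_subset_le h0 h1 hγ B x)
            (sq_nonneg R)).trans ?_
          rw [← mul_assoc]
          exact mul_le_mul_of_nonneg_right hBγ hx
    _ ≤ (ε / 2) ^ 2 * opNorm X ^ 2 * ∑ j, x j ^ 2 := by
        have h2 : (1 : ℝ) ≤ opNorm X ^ 2 := one_le_pow₀ hX
        have := mul_le_mul_of_nonneg_left h2 (mul_nonneg (sq_nonneg ε) hx)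
        nlinarith

theorem opNorm_mul_sub_rescale_le [NeZero p] {X : Matrix (Fin p) (Fin p) ℝ}
    (h0 : ∀ i j, 0 ≤ X i j) (h1 : ∀ i, ∑ j, X i j = 1) {γ ε R : ℝ}
    (hγ : ∀ j, ∑ i, X i j ^ 2 ≤ γ) (hε : 0 ≤ ε) {v : Fin p → ℝ} (hR : 1 ≤ R)
    (hv0 : ∀ i, 0 ≤ v i) (hvR : ∀ i, v i ≤ R) {B : Finset (Fin p)}
    (hB : ∀ i ∉ B, |1 - v i| ≤ ε / 4) (hBγ : R ^ 2 * √(B.card * γ) ≤ ε ^ 2 / 8)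
    {V Z : Matrix (Fin p) (Fin q) ℝ}
    (hZ : R ^ 2 * ∑ i, ∑ t, (Z i t - (X * V) i t) ^ 2 ≤ ε ^ 2 / 4 * opNorm V ^ 2) :
    opNorm (X * V - Matrix.diagonal v * Z) ≤ ε * opNorm X * opNorm V := by
  have hX := one_le_opNorm_of_row_sum_eq_one h1
  have hV := opNorm_nonneg V
  have hsplit : X * V - Matrix.diagonal v * Z =
      (1 - Matrix.diagonal v) * X * V + Matrix.diagonal v * (X * V - Z) := by
    rw [Matrix.sub_mul, Matrix.sub_mul, Matrix.one_mul, Matrix.mul_sub, Matrix.mul_assoc]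
    abel
  have hfst : opNorm ((1 - Matrix.diagonal v) * X * V) ≤ ε / 2 * opNorm X * opNorm V := by
    refine (opNorm_mul_le _ _).trans (mul_le_mul_of_nonneg_right ?_ hV)
    refine opNorm_rescale_sub_le h0 h1 hγ hε (fun i => ?_) hB hBγ
    rw [abs_le]
    constructor <;> linarith [hv0 i, hvR i]
  have hsnd : opNorm (Matrix.diagonal v * (X * V - Z)) ≤ ε / 2 * opNorm V := by
    refine opNorm_le_of_sum_sq_le (by positivity) (le_trans ?_ (hZ.trans_eq (by ring)))
    rw [Finset.mul_sum]
    refine Finset.sum_le_sum fun i _ => ?_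
    rw [Finset.mul_sum]
    refine Finset.sum_le_sum fun t _ => ?_
    rw [Matrix.diagonal_mul, Matrix.sub_apply, mul_pow, sub_sq_comm]
    gcongr
    · exact hv0 i
    · exact hvR i
  rw [hsplit]
  refine (opNorm_add_le _ _).trans ((add_le_add hfst hsnd).trans ?_)
  nlinarith [mul_nonneg (mul_nonneg hε hV) (sub_nonneg.2 hX)]

end norms

/-! ### The softmax matrix -/

section softmax

variable {n d : ℕ} (Q K : Matrix (Fin n) (Fin d) ℝ) (M : Matrix (Fin n) (Fin n) Bool)

/-- The sum of row `i` of `exp(Q Kᵀ)`. -/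
noncomputable def rowSum (i : Fin n) : ℝ := ∑ j, attnMatrix Q K i j

/-- The sum of the entries of row `i` of `exp(Q Kᵀ)` at the positions of the mask. -/
noncomputable def maskedRowSum (i : Fin n) : ℝ := ∑ j, if M i j then attnMatrix Q K i j else 0

theorem attnMatrix_pos (i j : Fin n) : 0 < attnMatrix Q K i j := Real.exp_pos _

theorem rowSum_pos (i : Fin n) : 0 < rowSum Q K i :=
  Finset.sum_pos (fun j _ => attnMatrix_pos Q K i j) ⟨i, Finset.mem_univ i⟩

theorem unmaskedRowSum_eq (i : Fin n) :
    unmaskedRowSum Q K M i = ∑ j, if M i j then 0 else attnMatrix Q K i j :=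
  Finset.sum_congr rfl fun j _ => by cases M i j <;> simp

theorem unmaskedRowSum_nonneg (i : Fin n) : 0 ≤ unmaskedRowSum Q K M i := by
  rw [unmaskedRowSum_eq]
  exact Finset.sum_nonneg fun j _ => by split_ifs <;> simp [(attnMatrix_pos Q K i j).le]

theorem maskedRowSum_nonneg (i : Fin n) : 0 ≤ maskedRowSum Q K M i :=
  Finset.sum_nonneg fun j _ => by split_ifs <;> simp [(attnMatrix_pos Q K i j).le]

theorem maskedRowSum_add_unmaskedRowSum (i : Fin n) :
    maskedRowSum Q K M i + unmaskedRowSum Q K M i = rowSum Q K i := by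
  rw [unmaskedRowSum_eq, maskedRowSum, ← Finset.sum_add_distrib, rowSum]
  exact Finset.sum_congr rfl fun j _ => by cases M i j <;> simp

theorem diagonal_inv_of_ne_zero {v : Fin n → ℝ} (h : ∀ i, v i ≠ 0) :
    (Matrix.diagonal v)⁻¹ = Matrix.diagonal fun i => (v i)⁻¹ := by
  refine Matrix.inv_eq_left_inv ?_
  rw [Matrix.diagonal_mul_diagonal, ← Matrix.diagonal_one]
  congr 1
  funext i
  exact inv_mul_cancel₀ (h i)

theorem softmaxMatrix_apply (i j : Fin n) :
    softmaxMatrix Q K i j = attnMatrix Q K i j / rowSum Q K i := by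
  have h : (fun i => ∑ j, |attnMatrix Q K i j|) = rowSum Q K := by
    funext i
    exact Finset.sum_congr rfl fun j _ => abs_of_pos (attnMatrix_pos Q K i j)
  rw [softmaxMatrix, rowSumMatrix, h, diagonal_inv_of_ne_zero fun i => (rowSum_pos Q K i).ne',
    Matrix.diagonal_mul, div_eq_inv_mul]

theorem softmaxMatrix_nonneg (i j : Fin n) : 0 ≤ softmaxMatrix Q K i j := by
  rw [softmaxMatrix_apply]
  exact div_nonneg (attnMatrix_pos Q K i j).le (rowSum_pos Q K i).le

theorem sum_softmaxMatrix (i : Fin n) : ∑ j, softmaxMatrix Q K i j = 1 := by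
  simp only [softmaxMatrix_apply, ← Finset.sum_div]
  exact div_self (rowSum_pos Q K i).ne'

theorem diagonal_inv_mul_attnMatrix {v : Fin n → ℝ} (h : ∀ i, 0 < v i) :
    (Matrix.diagonal v)⁻¹ * attnMatrix Q K =
      (Matrix.diagonal fun i => rowSum Q K i / v i) * softmaxMatrix Q K := by
  rw [diagonal_inv_of_ne_zero fun i => (h i).ne']
  ext i j
  rw [Matrix.diagonal_mul, Matrix.diagonal_mul, softmaxMatrix_apply]
  have := (rowSum_pos Q K i).ne'
  field_simp

end softmax

open Prog

/-! ### The laws of the outputs of the algorithms -/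

section values

variable {n d : ℕ}

theorem val_dot (x y : Fin d → ℝ) : (dot x y).val = PMF.pure (∑ t, x t * y t) := by
  rw [dot, val_sumOver (g := fun t => x t * y t) fun t => by simp [Instr.law, PMF.pure_bind],
    ← Fin.sum_univ_def]

theorem val_entry (Q K : Matrix (Fin n) (Fin d) ℝ) (i j : Fin n) :
    (entry Q K i j).val = PMF.pure (attnMatrix Q K i j) := by
  simp only [entry, val_bind, val_dot, PMF.pure_bind, val_exec, Instr.law]
  rfl

theorem sum_map_filter_eq {ι : Type} (p : ι → Bool) (f : ι → ℝ) (l : List ι) :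
    ((l.filter p).map f).sum = (l.map fun j => if p j then f j else 0).sum := by
  induction l with
  | nil => rfl
  | cons i l ih => by_cases h : p i = true <;> simp [h, ih]

variable (Q K V : Matrix (Fin n) (Fin d) ℝ) (M : Matrix (Fin n) (Fin n) Bool)

theorem val_maskedSum (i : Fin n) :
    (maskedSum Q K M i).val = PMF.pure (maskedRowSum Q K M i) := by
  rw [maskedSum, val_sumOver (val_entry Q K i), maskRow, sum_map_filter_eq, ← Fin.sum_univ_def]
  rfl

theorem val_unmaskedSum (i : Fin n) :
    (unmaskedSum Q K M i).val = PMF.pure (unmaskedRowSum Q K M i) := by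
  rw [unmaskedSum, val_sumOver (g := fun j => if M i j then 0 else attnMatrix Q K i j) fun j => by
      simp only [val_bind, val_exec, Instr.law, PMF.pure_bind]
      split_ifs <;> simp [val_entry], ← Fin.sum_univ_def, unmaskedRowSum_eq]

/-- The maximum of the unmasked row sums over `T`. -/
noncomputable def maxRowSum (T : Finset (Fin n)) : ℝ :=
  ((T.sort (· ≤ ·)).map (unmaskedRowSum Q K M)).foldr max 0

/-- The truncation level of row `i`. -/
noncomputable def truncLevel (c ε τκ : ℝ) (m : ℕ) (i : Fin n) : ℝ :=
  c * (ε * ε * m / (n * Real.log n)) * (maskedRowSum Q K M i + τκ)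

/-- The truncated contribution of position `j` to row `i`. -/
noncomputable def truncEntry (c ε τκ : ℝ) (m : ℕ) (i j : Fin n) : ℝ :=
  if M i j then 0 else min (attnMatrix Q K i j) (truncLevel Q K M c ε τκ m i)

/-- The estimate for the `i`-th row sum based on the samples `l`. -/
noncomputable def rowSumEstimate (c ε τκ : ℝ) {m : ℕ} (l : Fin m → Fin n) (i : Fin n) : ℝ :=
  maskedRowSum Q K M i + max (n / m * ∑ r, truncEntry Q K M c ε τκ m i (l r)) τκ

theorem val_approxD [NeZero n] (c κ ε : ℝ) (m : ℕ) :
    (approxD c Q K M κ ε m).val =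
      (PMF.uniformOfFinset _ (powersetCard_min_nonempty n m)).bind fun T =>
        (iid (PMF.uniformOfFintype (Fin n)) m).map fun l =>
          rowSumEstimate Q K M c ε (maxRowSum Q K M T / κ) l := by
  have htab (p : Prog (Fin n)) (hp : p = exec (.unif n)) : (tabulate m fun _ => p).val =
      iid (PMF.uniformOfFintype (Fin n)) m := by
    rw [val_tabulate_map (μ := PMF.uniformOfFintype (Fin n)) (g := id)
      (by rw [hp, val_exec, PMF.map_id, Instr.law])]
    exact PMF.map_id _
  simp only [approxD, val_bind, val_exec, htab _ rfl, Instr.law, PMF.pure_bind,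
    val_maxOver (val_unmaskedSum Q K M)]
  congr 1
  funext T
  rw [← PMF.bind_pure_comp]
  congr 1
  funext l
  refine val_tabulate_pure fun i => ?_
  simp only [val_bind, val_maskedSum, val_exec, Instr.law, PMF.pure_bind]
  rw [val_sumOver (g := fun r => truncEntry Q K M c ε (maxRowSum Q K M T / κ) m i (l r))]
  · rw [PMF.pure_bind, ← Fin.sum_univ_def]
    rfl
  · intro r
    simp only [val_bind, val_exec, Instr.law, PMF.pure_bind, truncEntry]
    split_ifs
    · simp
    · simp only [val_bind, val_entry, val_exec, Instr.law, PMF.pure_bind]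
      rfl

/-- The squared norm of row `i`. -/
noncomputable def rowSq (i : Fin n) : ℝ := ∑ t, V i t * V i t

/-- The coefficient of a sample of row `l`. -/
noncomputable def sampleCoeff (m : ℕ) (l : Fin n) : ℝ := √(∑ i, rowSq V i) / (√m * √(rowSq V l))

theorem val_rowNormSample [NeZero n] (m : ℕ) :
    (rowNormSample V m).val =
      (iid (weightedPMF (rowSq V)) m).map fun l r => (l r, sampleCoeff V m (l r)) := by
  simp only [rowNormSample, val_bind, val_tabulate_pure fun i => val_dot (V i) (V i),
    PMF.pure_bind, val_sumOver (f := fun i => exec (.load (∑ t, V i t * V i t)))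
      (g := rowSq V) fun i => val_exec _, val_exec, Instr.law, ← Fin.sum_univ_def]
  refine val_tabulate_map (g := fun l => (l, sampleCoeff V m l)) ?_ m
  simp only [val_bind, val_exec, Instr.law, PMF.pure_bind, val_pure]
  rw [← PMF.bind_pure_comp]
  rfl

theorem val_hyperAttention [NeZero n] (c κ ε : ℝ) (mD mS : ℕ) :
    (hyperAttention c Q K V M κ ε mD mS).val =
      (PMF.uniformOfFinset _ (powersetCard_min_nonempty n mD)).bind fun T =>
        (iid (PMF.uniformOfFintype (Fin n)) mD).bind fun l =>
          (iid (weightedPMF (rowSq V)) mS).map fun l' =>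
            (rowSumEstimate Q K M c ε (maxRowSum Q K M T / κ) l,
              fun r => (l' r, sampleCoeff V mS (l' r))) := by
  simp only [hyperAttention, val_bind, val_approxD, val_rowNormSample, PMF.bind_bind,
    PMF.bind_map, Function.comp_def, val_pure]
  rfl

end values

/-! ### The number of steps -/

section cost

variable {n d : ℕ} (Q K V : Matrix (Fin n) (Fin d) ℝ) (M : Matrix (Fin n) (Fin n) Bool)

theorem costLE_dot (x y : Fin d → ℝ) : (dot x y).CostLE (5 * d) := by
  refine (costLE_sumOver (N := 1 + (1 + 1)) (fun t => ?_) _).mono (by rw [List.length_finRange]; omega)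
  exact (costLE_exec (.load (x t))).bind fun _ => (costLE_exec (.load (y t))).bind fun _ =>
    costLE_exec (.mul _ _)

theorem costLE_entry (i j : Fin n) : (entry Q K i j).CostLE (5 * d + 1) :=
  (costLE_dot _ _).bind fun _ => costLE_exec (.exp _)

theorem costLE_maskedSum (i : Fin n) :
    (maskedSum Q K M i).CostLE ((maskRow M i).length * (5 * d + 3)) :=
  costLE_sumOver (costLE_entry Q K i) _

theorem costLE_unmaskedSum (i : Fin n) : (unmaskedSum Q K M i).CostLE (n * (5 * d + 4)) := by
  refine (costLE_sumOver (N := 1 + (5 * d + 1)) (fun j => ?_) _).mono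
    (by rw [List.length_finRange]; linarith)
  refine (costLE_exec (.test (M i j))).bind fun b => ?_
  split_ifs
  · exact (costLE_pure _).mono (Nat.zero_le _)
  · exact costLE_entry Q K i j

theorem sum_length_maskRow : ∑ i, (maskRow M i).length = nnz M := by
  have h (i : Fin n) : (maskRow M i).length = ∑ j, if M i j = true then 1 else 0 := by
    rw [maskRow, ← List.countP_eq_length_filter, Finset.sum_boole, Fin.univ_def]
    simp [Finset.card, Finset.filter, List.countP_eq_length_filter]
  rw [nnz, Finset.card_filter, Fintype.sum_prod_type]
  exact Finset.sum_congr rfl fun i _ => h i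

theorem costLE_approxD [NeZero n] (c κ ε : ℝ) (m : ℕ) :
    (approxD c Q K M κ ε m).CostLE
      (n + m * (n * (5 * d + 4) + 2) + 2 * m + 8 + (nnz M * (5 * d + 3) +
        n * (m * (5 * d + 5) + 6))) := by
  refine CostLE.mono (N := n + (m * (n * (5 * d + 4) + 2) + (1 + (m * (1 + 1) + (1 + (1 + (1 +
    (1 + (1 + (1 + (1 + (nnz M * (5 * d + 3) + n * (m * (5 * d + 5) + 6))))))))))))) ?_ (by omega)
  refine (costLE_exec (.subset n m)).bind_of_support fun T hT => ?_
  have hcard : (T.sort (· ≤ ·)).length ≤ m := by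
    rw [val_exec, Instr.law, PMF.mem_support_uniformOfFinset_iff, Finset.mem_powersetCard] at hT
    rw [Finset.length_sort, hT.2]
    exact min_le_left _ _
  refine ((costLE_maxOver (costLE_unmaskedSum Q K M) _).mono
    (Nat.mul_le_mul_right _ hcard)).bind fun τ => ?_
  refine (costLE_exec (.div τ κ)).bind fun τκ => ?_
  refine ((costLE_tabulate (N := fun _ => 1) fun _ => costLE_exec (.unif n)).mono
    (by simp)).bind fun l => ?_
  refine (costLE_exec (.log n)).bind fun L => ?_
  refine (costLE_exec (.mul n L)).bind fun nL => ?_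
  refine (costLE_exec (.mul ε ε)).bind fun ε2 => ?_
  refine (costLE_exec (.mul ε2 m)).bind fun ε2m => ?_
  refine (costLE_exec (.div ε2m nL)).bind fun q => ?_
  refine (costLE_exec (.mul c q)).bind fun cq => ?_
  refine (costLE_exec (.div n m)).bind fun nm => ?_
  refine (costLE_tabulate (N := fun i => (maskRow M i).length * (5 * d + 3) +
    (1 + (1 + (m * (5 * d + 5) + (1 + (1 + 1)))))) fun i => ?_).mono ?_
  · refine (costLE_maskedSum Q K M i).bind fun b => ?_
    refine (costLE_exec (.add b τκ)).bind fun bτ => ?_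
    refine (costLE_exec (.mul cq bτ)).bind fun Ci => ?_
    refine ((costLE_sumOver (N := 1 + (5 * d + 1 + 1)) (fun j => ?_) _).mono
      (by rw [List.length_finRange]; linarith)).bind fun s => ?_
    · refine (costLE_exec (.test (M i (l j)))).bind fun z => ?_
      split_ifs
      · exact (costLE_pure _).mono (Nat.zero_le _)
      · exact (costLE_entry Q K i (l j)).bind fun a => costLE_exec (.min a Ci)
    refine (costLE_exec (.mul nm s)).bind fun di => ?_
    exact (costLE_exec (.max di τκ)).bind fun ei => costLE_exec (.add b ei)
  · rw [← sum_length_maskRow, Finset.sum_mul]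
    simp only [add_assoc, Finset.sum_add_distrib, Finset.sum_const, Finset.card_univ,
      Fintype.card_fin, smul_eq_mul]
    linarith

theorem costLE_rowNormSample [NeZero n] (m : ℕ) :
    (rowNormSample V m).CostLE (n * (5 * d + 1) + n * 3 + 2 + m * (n + 4)) := by
  refine CostLE.mono (N := n * (5 * d + 1) + (n * (1 + 2) + (1 + (1 + m * (n + 4))))) ?_ (by omega)
  refine ((costLE_tabulate fun i => costLE_dot (V i) (V i)).mono (by simp)).bind fun w => ?_
  refine ((costLE_sumOver (fun i => costLE_exec (.load (w i))) _).mono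
    (by simp)).bind fun F2 => ?_
  refine (costLE_exec (.sqrt F2)).bind fun F => ?_
  refine (costLE_exec (.sqrt m)).bind fun sm => ?_
  refine (costLE_tabulate (N := fun _ => n + (1 + (1 + (1 + 0)))) fun _ => ?_).mono (by simp)
  refine (costLE_exec (.draw w)).bind fun l => ?_
  refine (costLE_exec (.sqrt (w l))).bind fun v => ?_
  refine (costLE_exec (.mul sm v)).bind fun p => ?_
  exact (costLE_exec (.div F p)).bind fun x => costLE_pure _

theorem costLE_hyperAttention [NeZero n] (c κ ε : ℝ) (mD mS : ℕ) (hd : 0 < d) (hD : 0 < mD)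
    (hS : 0 < mS) :
    (hyperAttention c Q K V M κ ε mD mS).CostLE
      (100 * (d * n * mD + n * mS + d * n + d * nnz M)) := by
  refine ((costLE_approxD Q K M c κ ε mD).bind fun D' => (costLE_rowNormSample V mS).bind fun S =>
    costLE_pure _).mono ?_
  have hn : 1 ≤ n := Nat.pos_of_ne_zero (NeZero.ne n)
  have h1 : n * mD ≤ d * n * mD := by nlinarith [Nat.mul_le_mul_right (n * mD) hd]
  have h2 : mD ≤ n * mD := Nat.le_mul_of_pos_left _ hn
  have h3 : n ≤ d * n := Nat.le_mul_of_pos_left _ hd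
  have h4 : mS ≤ n * mS := Nat.le_mul_of_pos_left _ hn
  have h5 : nnz M ≤ d * nnz M := Nat.le_mul_of_pos_left _ hd
  nlinarith

end cost
/-! ### Sampling rows according to their norms -/

section sampling

variable {n d : ℕ}

theorem rowSq_nonneg (V : Matrix (Fin n) (Fin d) ℝ) (i : Fin n) : 0 ≤ rowSq V i :=
  Finset.sum_nonneg fun _ _ => mul_self_nonneg _

theorem toReal_weightedPMF [NeZero n] {w : Fin n → ℝ} (hw : ∀ i, 0 ≤ w i) (h : ∑ i, w i ≠ 0)
    (i : Fin n) : (weightedPMF w i).toReal = w i / ∑ j, w j := by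
  have hsum : ∑' i, ENNReal.ofReal (w i) = ENNReal.ofReal (∑ i, w i) := by
    rw [tsum_fintype, ENNReal.ofReal_sum_of_nonneg fun i _ => hw i]
  have hpos : 0 ≤ ∑ i, w i := Finset.sum_nonneg fun i _ => hw i
  have hne : (∑' i, ENNReal.ofReal (w i)) ≠ 0 := by
    rw [hsum, Ne, ENNReal.ofReal_eq_zero, not_le]
    exact lt_of_le_of_ne hpos h.symm
  rw [weightedPMF, dif_pos hne, PMF.normalize_apply, hsum, ENNReal.toReal_mul, ENNReal.toReal_inv,
    ENNReal.toReal_ofReal (hw i), ENNReal.toReal_ofReal hpos, div_eq_mul_inv]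

theorem eq_zero_of_rowSq_eq_zero {V : Matrix (Fin n) (Fin d) ℝ} {i : Fin n} (h : rowSq V i = 0)
    (t : Fin d) : V i t = 0 :=
  mul_self_eq_zero.1
    ((Finset.sum_eq_zero_iff_of_nonneg fun _ _ => mul_self_nonneg _).1 h t (Finset.mem_univ t))

/-- Importance weights cancel the sampling probabilities. -/
theorem weightedPMF_rowSq_mul [NeZero n] (V : Matrix (Fin n) (Fin d) ℝ) (i : Fin n) (t : Fin d) :
    (weightedPMF (rowSq V) i).toReal * ((∑ k, rowSq V k) / rowSq V i * V i t) = V i t := by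
  by_cases h : rowSq V i = 0
  · simp [eq_zero_of_rowSq_eq_zero h t]
  · have hF : ∑ k, rowSq V k ≠ 0 := fun h0 => h
      ((Finset.sum_eq_zero_iff_of_nonneg fun k _ => rowSq_nonneg V k).1 h0 i (Finset.mem_univ i))
    rw [toReal_weightedPMF (rowSq_nonneg V) hF]
    field_simp

theorem mul_samplingMatrix_apply (X : Matrix (Fin n) (Fin n) ℝ) (V : Matrix (Fin n) (Fin d) ℝ)
    {m : ℕ} (S : Fin m → Fin n × ℝ) (i : Fin n) (t : Fin d) :
    (X * (samplingMatrix S)ᵀ * (samplingMatrix S * V)) i t =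
      ∑ r, (S r).2 ^ 2 * (X i (S r).1 * V (S r).1 t) := by
  rw [Matrix.mul_apply]
  refine Finset.sum_congr rfl fun r _ => ?_
  have h1 : (X * (samplingMatrix S)ᵀ) i r = X i (S r).1 * (S r).2 := by
    simp [Matrix.mul_apply, samplingMatrix, Pi.single_apply]
  have h2 : (samplingMatrix S * V) r t = (S r).2 * V (S r).1 t := by
    simp [Matrix.mul_apply, samplingMatrix, Pi.single_apply]
  rw [h1, h2]
  ring

theorem sampleCoeff_sq (V : Matrix (Fin n) (Fin d) ℝ) (m : ℕ) (l : Fin n) :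
    sampleCoeff V m l ^ 2 = (∑ k, rowSq V k) / rowSq V l / m := by
  rw [sampleCoeff, div_pow, mul_pow, Real.sq_sqrt (Finset.sum_nonneg fun k _ => rowSq_nonneg V k),
    Real.sq_sqrt (Nat.cast_nonneg m), Real.sq_sqrt (rowSq_nonneg V l), div_div, mul_comm (m : ℝ)]

/-- Approximate matrix multiplication by sampling rows according to their squared norms. -/
theorem expect_sampling_error_le [NeZero n] (X : Matrix (Fin n) (Fin n) ℝ)
    (V : Matrix (Fin n) (Fin d) ℝ) {m : ℕ} (hm : 0 < m) :
    expect (iid (weightedPMF (rowSq V)) m) (fun l => ∑ i, ∑ t,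
      ((X * (samplingMatrix fun r => (l r, sampleCoeff V m (l r)))ᵀ *
        ((samplingMatrix fun r => (l r, sampleCoeff V m (l r))) * V)) i t - (X * V) i t) ^ 2) ≤
      (∑ i, ∑ k, X i k ^ 2) * (∑ k, rowSq V k) / m := by
  set μ := weightedPMF (rowSq V) with hμ
  set F := ∑ k, rowSq V k with hF
  have hF0 : 0 ≤ F := Finset.sum_nonneg fun k _ => rowSq_nonneg V k
  set y : Fin n → Fin d → Fin n → ℝ := fun i t k => X i k * (F / rowSq V k * V k t) with hy
  have hmean (i : Fin n) (t : Fin d) : expect μ (y i t) = (X * V) i t := by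
    rw [expect, Matrix.mul_apply]
    refine Finset.sum_congr rfl fun k _ => ?_
    rw [hy, mul_left_comm, weightedPMF_rowSq_mul]
  have hsq (i : Fin n) : ∑ t, expect μ (fun k => y i t k ^ 2) ≤ F * ∑ k, X i k ^ 2 := by
    simp only [expect]
    rw [Finset.sum_comm, Finset.mul_sum]
    refine Finset.sum_le_sum fun k _ => ?_
    have h (t : Fin d) : (μ k).toReal * y i t k ^ 2 =
        F / rowSq V k * (X i k ^ 2 * (V k t * V k t)) := by
      calc (μ k).toReal * y i t k ^ 2
          = X i k ^ 2 * ((μ k).toReal * (F / rowSq V k * V k t)) * (F / rowSq V k * V k t) := by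
            simp only [hy]
            ring
        _ = _ := by
            rw [weightedPMF_rowSq_mul]
            ring
    simp only [h]
    rw [← Finset.mul_sum, ← Finset.mul_sum]
    change F / rowSq V k * (X i k ^ 2 * rowSq V k) ≤ _
    by_cases hk : rowSq V k = 0
    · rw [hk]
      simp only [mul_zero]
      positivity
    · exact le_of_eq (by field_simp)
  have hZ (l : Fin m → Fin n) (i : Fin n) (t : Fin d) :
      (X * (samplingMatrix fun r => (l r, sampleCoeff V m (l r)))ᵀ *
        ((samplingMatrix fun r => (l r, sampleCoeff V m (l r))) * V)) i t =
      (∑ r, y i t (l r)) / m := by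
    rw [mul_samplingMatrix_apply, Finset.sum_div]
    refine Finset.sum_congr rfl fun r _ => ?_
    simp only [sampleCoeff_sq, hy]
    ring
  simp only [hZ, expect_sum, ← hmean]
  calc _ ≤ ∑ i, ∑ t, expect μ (fun k => y i t k ^ 2) / m :=
        Finset.sum_le_sum fun i _ => Finset.sum_le_sum fun t _ =>
          expect_iid_sq_mean_sub_le μ hm (y i t)
    _ ≤ ∑ i, F * (∑ k, X i k ^ 2) / m := by
        refine Finset.sum_le_sum fun i _ => ?_
        rw [← Finset.sum_div]
        gcongr
        exact hsq i
    _ = _ := by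
        rw [← Finset.sum_div, ← Finset.mul_sum, mul_comm]

end sampling

/-! ### Estimating the row sums -/

section rowSums

variable {n d : ℕ} (Q K V : Matrix (Fin n) (Fin d) ℝ) (M : Matrix (Fin n) (Fin n) Bool)

theorem spectralGuarantee_of_estimates [NeZero n] {D' : Fin n → ℝ} {R γ ε : ℝ} (hR : 1 ≤ R)
    (hγ : ∀ j, ∑ i, softmaxMatrix Q K i j ^ 2 ≤ γ) (hε0 : 0 < ε) (hε1 : ε ≤ 1)
    (hD : ∀ i, rowSum Q K i ≤ R * D' i) {B : Finset (Fin n)}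
    (hB : ∀ i ∉ B, |D' i - rowSum Q K i| ≤ ε / 8 * rowSum Q K i)
    (hBγ : R ^ 2 * √(B.card * γ) ≤ ε ^ 2 / 8) {m : ℕ} {S : Matrix (Fin m) (Fin n) ℝ}
    (hS : R ^ 2 * ∑ i, ∑ t, ((softmaxMatrix Q K * Sᵀ * (S * V)) i t -
      (softmaxMatrix Q K * V) i t) ^ 2 ≤ ε ^ 2 / 4 * opNorm V ^ 2) :
    SpectralGuarantee Q K V ε D' S := by
  have hpos (i : Fin n) : 0 < D' i :=
    pos_of_mul_pos_right ((rowSum_pos Q K i).trans_le (hD i)) (by positivity)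
  refine ⟨hpos, ?_⟩
  rw [diagonal_inv_mul_attnMatrix Q K hpos, Matrix.mul_assoc, Matrix.mul_assoc,
    ← Matrix.mul_assoc (softmaxMatrix Q K), attention]
  refine opNorm_mul_sub_rescale_le (softmaxMatrix_nonneg Q K) (sum_softmaxMatrix Q K) hγ hε0.le hR
    (fun i => div_nonneg (rowSum_pos Q K i).le (hpos i).le)
    (fun i => (div_le_iff₀ (hpos i)).2 (hD i)) (fun i hi => ?_) hBγ hS
  have h := abs_le.1 (hB i hi)
  have h0 := rowSum_pos Q K i
  have : (1 : ℝ) - rowSum Q K i / D' i = (D' i - rowSum Q K i) / D' i := by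
    rw [sub_div, div_self (hpos i).ne']
  rw [this, abs_div, abs_of_pos (hpos i), div_le_iff₀ (hpos i)]
  refine (hB i hi).trans ?_
  nlinarith [mul_nonneg hε0.le h0.le]

/-- The rows for which the estimate of the row sum is off by more than a factor `1 ± ε / 8`. -/
noncomputable def badRows (ε : ℝ) (D' : Fin n → ℝ) : Finset (Fin n) := by
  classical
  exact Finset.univ.filter fun i => ε / 8 * rowSum Q K i < |D' i - rowSum Q K i|

theorem expect_card_badRows_le [NeZero n] {R ε θ : ℝ} (hn : 2 ≤ n) (hε0 : 0 < ε)
    (hθ : ∀ i, θ ≤ unmaskedRowSum Q K M i) (hR : 0 < R)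
    (hD : ∀ i, rowSum Q K i ≤ R * (maskedRowSum Q K M i + θ)) {m : ℕ} (hm : 0 < m) :
    expect (iid (PMF.uniformOfFintype (Fin n)) m)
      (fun l => ((badRows Q K ε (rowSumEstimate Q K M 1 ε θ l)).card : ℝ)) ≤
      n / m * (256 / ε ^ 2 + 16 * R * Real.log n / ε ^ 3) *
        ∑ i, ∑ j, softmaxMatrix Q K i j ^ 2 := by
  classical
  set μ := PMF.uniformOfFintype (Fin n) with hμ
  have hn0 : (0 : ℝ) < n := by positivity
  have hm0 : (0 : ℝ) < m := by exact_mod_cast hm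
  have hlog : 0 < Real.log n := Real.log_pos (by exact_mod_cast hn)
  set A := attnMatrix Q K with hA
  set y := truncEntry Q K M 1 ε θ m with hy
  have hA0 (i j : Fin n) : 0 < A i j := attnMatrix_pos Q K i j
  have hD0 (i : Fin n) : 0 < rowSum Q K i := rowSum_pos Q K i
  have hC (i : Fin n) : ε ^ 2 * m * rowSum Q K i / (n * Real.log n * R) ≤
      truncLevel Q K M 1 ε θ m i := by
    rw [truncLevel, div_le_iff₀ (by positivity)]
    refine (mul_le_mul_of_nonneg_left (hD i) (by positivity)).trans_eq ?_
    field_simp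
  have hC0 (i : Fin n) : 0 < truncLevel Q K M 1 ε θ m i :=
    lt_of_lt_of_le (by have := hD0 i; positivity) (hC i)
  have hy0 (i j : Fin n) : 0 ≤ y i j := by
    simp only [hy, truncEntry]
    split_ifs
    · exact le_rfl
    · exact le_min (hA0 i j).le (hC0 i).le
  have hyA (i j : Fin n) : y i j ≤ A i j := by
    simp only [hy, truncEntry]
    split_ifs
    · exact (hA0 i j).le
    · exact min_le_left _ _
  have hbias (i : Fin n) : |∑ j, y i j - unmaskedRowSum Q K M i| ≤
      (∑ j, A i j ^ 2) / truncLevel Q K M 1 ε θ m i := by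
    rw [unmaskedRowSum_eq, ← Finset.sum_sub_distrib, Finset.sum_div]
    refine (Finset.abs_sum_le_sum_abs _ _).trans (Finset.sum_le_sum fun j _ => ?_)
    have h0 := hC0 i
    have h1 := hA0 i j
    simp only [hy, truncEntry]
    split_ifs
    · rw [sub_zero, abs_zero]
      positivity
    · rcases le_total (A i j) (truncLevel Q K M 1 ε θ m i) with h | h
      · rw [min_eq_left h, sub_self, abs_zero]
        positivity
      · rw [min_eq_right h, abs_of_nonpos (by linarith), le_div_iff₀ h0]
        nlinarith
  have hmean (i : Fin n) : expect μ (fun j => n * y i j) = ∑ j, y i j := by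
    rw [expect_uniform, ← Finset.mul_sum]
    field_simp
  -- The variance and the bias of the estimate of row `i`.
  set W : Fin n → (Fin m → Fin n) → ℝ :=
    fun i l => ((∑ r, n * y i (l r)) / m - ∑ j, y i j) ^ 2 with hW
  set b : Fin n → ℝ := fun i => (∑ j, A i j ^ 2) / truncLevel Q K M 1 ε θ m i with hb
  have hvar (i : Fin n) : expect (iid μ m) (W i) ≤ n / m * ∑ j, A i j ^ 2 := by
    have h := expect_iid_sq_mean_sub_le μ hm fun j => n * y i j
    rw [hmean] at h
    refine h.trans ?_
    rw [expect_uniform, div_mul_eq_mul_div]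
    gcongr
    rw [div_le_iff₀ hn0, Finset.mul_sum, Finset.sum_mul]
    refine Finset.sum_le_sum fun j _ => ?_
    have := pow_le_pow_left₀ (hy0 i j) (hyA i j) 2
    nlinarith [mul_le_mul_of_nonneg_left this (mul_pos hn0 hn0).le]
  have hest (l : Fin m → Fin n) (i : Fin n) :
      |rowSumEstimate Q K M 1 ε θ l i - rowSum Q K i| ≤ √(W i l) + b i := by
    have h1 : n / m * ∑ r, y i (l r) = (∑ r, n * y i (l r)) / m := by
      rw [← Finset.mul_sum]
      ring
    have h2 := hbias i
    rw [rowSumEstimate, ← hy, h1, ← maskedRowSum_add_unmaskedRowSum Q K M i,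
      add_sub_add_left_eq_sub, hW, Real.sqrt_sq_eq_abs]
    set x := (∑ r, n * y i (l r)) / m
    have h3 : |max x θ - unmaskedRowSum Q K M i| ≤ |x - unmaskedRowSum Q K M i| := by
      rcases le_total x θ with h | h
      · have := hθ i
        rw [max_eq_right h, abs_of_nonpos (by linarith), abs_of_nonpos (by linarith)]
        linarith
      · rw [max_eq_left h]
    exact h3.trans ((abs_sub_le x (∑ j, y i j) _).trans (add_le_add_right h2 _))
  have hind (l : Fin m → Fin n) (i : Fin n) :
      (if ε / 8 * rowSum Q K i < |rowSumEstimate Q K M 1 ε θ l i - rowSum Q K i| then (1 : ℝ)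
        else 0) ≤ 256 / (ε ^ 2 * rowSum Q K i ^ 2) * W i l + 16 / (ε * rowSum Q K i) * b i := by
    have h0 := hD0 i
    have hb0 : 0 ≤ b i := div_nonneg (Finset.sum_nonneg fun j _ => sq_nonneg _) (hC0 i).le
    have hW0 : 0 ≤ W i l := sq_nonneg _
    split_ifs with hbad
    · have h1 := hbad.trans_le (hest l i)
      rcases le_total (ε / 16 * rowSum Q K i) (b i) with h2 | h2
      · have : 1 ≤ 16 / (ε * rowSum Q K i) * b i := by
          rw [div_mul_eq_mul_div, le_div_iff₀ (by positivity)]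
          linarith
        have : 0 ≤ 256 / (ε ^ 2 * rowSum Q K i ^ 2) * W i l := by positivity
        linarith
      · have h3 : ε / 16 * rowSum Q K i ≤ √(W i l) := by linarith
        have h4 := pow_le_pow_left₀ (by positivity) h3 2
        rw [Real.sq_sqrt hW0] at h4
        have : 1 ≤ 256 / (ε ^ 2 * rowSum Q K i ^ 2) * W i l := by
          rw [div_mul_eq_mul_div, le_div_iff₀ (by positivity)]
          nlinarith
        have : 0 ≤ 16 / (ε * rowSum Q K i) * b i := by positivity
        linarith
    · positivity
  have hcard (l : Fin m → Fin n) : ((badRows Q K ε (rowSumEstimate Q K M 1 ε θ l)).card : ℝ) ≤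
      ∑ i, (256 / (ε ^ 2 * rowSum Q K i ^ 2) * W i l + 16 / (ε * rowSum Q K i) * b i) := by
    rw [badRows, Finset.card_filter]
    push_cast
    exact Finset.sum_le_sum fun i _ => hind l i
  refine (expect_mono _ hcard).trans ?_
  rw [expect_sum, Finset.mul_sum]
  refine Finset.sum_le_sum fun i _ => ?_
  have h0 := hD0 i
  have hA2 : 0 ≤ ∑ j, A i j ^ 2 := Finset.sum_nonneg fun j _ => sq_nonneg _
  have hP : ∑ j, softmaxMatrix Q K i j ^ 2 = (∑ j, A i j ^ 2) / rowSum Q K i ^ 2 := by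
    simp only [softmaxMatrix_apply, div_pow, Finset.sum_div, hA]
  rw [expect_add, expect_const, expect_const_mul, hP]
  have h1 : 256 / (ε ^ 2 * rowSum Q K i ^ 2) * expect (iid μ m) (W i) ≤
      256 / (ε ^ 2 * rowSum Q K i ^ 2) * (n / m * ∑ j, A i j ^ 2) := by
    gcongr
    exact hvar i
  have h2 : 16 / (ε * rowSum Q K i) * b i ≤ 16 / (ε * rowSum Q K i) *
      ((∑ j, A i j ^ 2) / (ε ^ 2 * m * rowSum Q K i / (n * Real.log n * R))) := by
    refine mul_le_mul_of_nonneg_left ?_ (by positivity)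
    exact div_le_div_of_nonneg_left hA2 (by positivity) (hC i)
  refine (add_le_add h1 h2).trans_eq ?_
  field_simp

end rowSums
/-! ### The success probability -/

section success

variable {n d : ℕ} (Q K V : Matrix (Fin n) (Fin d) ℝ) (M : Matrix (Fin n) (Fin n) Bool)

theorem sum_rowSq_le_opNorm : ∑ i, rowSq V i ≤ d * opNorm V ^ 2 := by
  refine le_trans (le_of_eq ?_) (sum_sq_le_opNorm V)
  exact Finset.sum_congr rfl fun i _ => Finset.sum_congr rfl fun t _ => (sq _).symm

theorem foldr_max_le {l : List ℝ} {x : ℝ} (hx : 0 ≤ x) (h : ∀ y ∈ l, y ≤ x) :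
    l.foldr max 0 ≤ x := by
  induction l with
  | nil => exact hx
  | cons y l ih =>
    exact max_le (h y List.mem_cons_self) (ih fun z hz => h z (List.mem_cons_of_mem _ hz))

theorem le_foldr_max {l : List ℝ} {y : ℝ} (h : y ∈ l) : y ≤ l.foldr max 0 := by
  induction l with
  | nil => simp at h
  | cons z l ih =>
    rcases List.mem_cons.1 h with rfl | h
    · exact le_max_left _ _
    · exact (ih h).trans (le_max_right _ _)

theorem unmaskedRowSum_le_maxRowSum {T : Finset (Fin n)} {j : Fin n} (hj : j ∈ T) :
    unmaskedRowSum Q K M j ≤ maxRowSum Q K M T :=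
  le_foldr_max (List.mem_map_of_mem ((Finset.mem_sort _).2 hj))

theorem maxRowSum_le {T : Finset (Fin n)} {x : ℝ} (hx : 0 ≤ x)
    (h : ∀ j, unmaskedRowSum Q K M j ≤ x) : maxRowSum Q K M T ≤ x := by
  refine foldr_max_le hx fun y hy => ?_
  obtain ⟨j, _, rfl⟩ := List.mem_map.1 hy
  exact h j

theorem le_expect_indicator {α γ : Type} [Fintype α] [Fintype γ] (μ : PMF α) (ν : PMF γ)
    {s : α → γ → Prop} [∀ a c, Decidable (s a c)] {f : α → ℝ} {g : γ → ℝ} {x y : ℝ}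
    (h : ∀ a c, f a ≤ 1 → g c ≤ 1 → s a c) (hf0 : ∀ a, 0 ≤ f a) (hg0 : ∀ c, 0 ≤ g c)
    (hf : expect μ f ≤ x) (hg : expect ν g ≤ y) :
    1 - x - y ≤ expect μ fun a => expect ν fun c => if s a c then 1 else 0 := by
  have h1 (a : α) (c : γ) : 1 - f a - g c ≤ if s a c then 1 else 0 := by
    split_ifs with hs
    · linarith [hf0 a, hg0 c]
    · by_contra! hlt
      exact hs (h a c (by linarith [hg0 c]) (by linarith [hf0 a]))
  have h2 : expect μ (fun a => expect ν fun c => 1 - f a - g c) = 1 - expect μ f - expect ν g := by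
    simp only [expect_sub, expect_const]
  exact le_trans (by linarith) (h2.ge.trans (expect_mono μ fun a => expect_mono ν (h1 a)))

theorem le_toOuterMeasure_spectralGuarantee [NeZero n] (hn : 2 ≤ n) {ε θ L G : ℝ} (hL : 1 ≤ L)
    (hG : 6400 * (256 + 16 * Real.log n) ≤ G) (hε0 : 0 < ε) (hε1 : ε ≤ 1) (hεL : 1 / ε ≤ L)
    (hcol : ∀ j, ∑ i, softmaxMatrix Q K i j ^ 2 ≤ L / n)
    (hθ : ∀ i, θ ≤ unmaskedRowSum Q K M i)
    (hD : ∀ i, rowSum Q K i ≤ L ^ 2 * (maskedRowSum Q K M i + θ)) {mD mS : ℕ}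
    (hd : 0 < d) (hmD : L ^ 20 * G ≤ mD) (hmS : d * (L ^ 20 * G) ≤ mS) :
    ENNReal.ofReal 0.98 ≤
      ((iid (PMF.uniformOfFintype (Fin n)) mD).bind fun l =>
        (iid (weightedPMF (rowSq V)) mS).map fun l' =>
          (rowSumEstimate Q K M 1 ε θ l, fun r => (l' r, sampleCoeff V mS (l' r)))).toOuterMeasure
        {r | SpectralGuarantee Q K V ε r.1 (samplingMatrix r.2)} := by
  classical
  have hL0 : 0 < L := by linarith
  have hn0 : (0 : ℝ) < n := by positivity
  have hd0 : (0 : ℝ) < d := by exact_mod_cast hd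
  have hlog : 0 < Real.log n := Real.log_pos (by exact_mod_cast hn)
  have hG0 : 0 < G := by linarith
  have hmD0 : (0 : ℝ) < mD := lt_of_lt_of_le (by positivity) hmD
  have hmS0 : (0 : ℝ) < mS := lt_of_lt_of_le (by positivity) hmS
  have hV0 := opNorm_nonneg V
  have hεL' : 1 ≤ ε * L := by rwa [div_le_iff₀' hε0] at hεL
  have hF : ∑ i, ∑ j, softmaxMatrix Q K i j ^ 2 ≤ L := by
    rw [Finset.sum_comm]
    refine (Finset.sum_le_sum fun j _ => hcol j).trans_eq ?_
    rw [Finset.sum_const, Finset.card_univ, Fintype.card_fin, nsmul_eq_mul]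
    field_simp
  set X := softmaxMatrix Q K with hX
  set S : (Fin mS → Fin n) → Matrix (Fin mS) (Fin n) ℝ :=
    fun l' => samplingMatrix fun r => (l' r, sampleCoeff V mS (l' r)) with hS
  set f : (Fin mD → Fin n) → ℝ :=
    fun l => 64 * L ^ 13 / n * (badRows Q K ε (rowSumEstimate Q K M 1 ε θ l)).card with hf
  set err : (Fin mS → Fin n) → ℝ :=
    fun l' => ∑ i, ∑ t, ((X * (S l')ᵀ * (S l' * V)) i t - (X * V) i t) ^ 2 with herr
  set g : (Fin mS → Fin n) → ℝ := fun l' => 4 * L ^ 6 / opNorm V ^ 2 * err l' with hg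
  have herr0 (l' : Fin mS → Fin n) : 0 ≤ err l' :=
    Finset.sum_nonneg fun i _ => Finset.sum_nonneg fun t _ => sq_nonneg _
  have hgood (l : Fin mD → Fin n) (l' : Fin mS → Fin n) (h1 : f l ≤ 1) (h2 : g l' ≤ 1) :
      SpectralGuarantee Q K V ε (rowSumEstimate Q K M 1 ε θ l) (S l') := by
    refine spectralGuarantee_of_estimates Q K V (R := L ^ 2) (γ := L / n)
      (B := badRows Q K ε (rowSumEstimate Q K M 1 ε θ l)) (one_le_pow₀ hL) hcol hε0 hε1
      (fun i => (hD i).trans ?_) (fun i hi => ?_) ?_ ?_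
    · refine mul_le_mul_of_nonneg_left ?_ (by positivity)
      exact add_le_add_right (le_max_right _ _) _
    · simpa [badRows] using hi
    · have h3 : √((badRows Q K ε (rowSumEstimate Q K M 1 ε θ l)).card * (L / n)) ≤
          1 / (8 * L ^ 6) := by
        rw [Real.sqrt_le_left (by positivity), div_pow, le_div_iff₀ (by positivity)]
        simp only [hf] at h1
        refine le_trans (le_of_eq ?_) (h1.trans (by norm_num))
        field_simp
        ring
      refine (mul_le_mul_of_nonneg_left h3 (by positivity)).trans ?_
      have h4 : (L ^ 2) ^ 2 * (1 / (8 * L ^ 6)) = (1 / L) ^ 2 / 8 := by field_simp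
      rw [h4]
      gcongr
      rwa [div_le_iff₀ hL0]
    · change (L ^ 2) ^ 2 * err l' ≤ _
      rcases hV0.eq_or_lt with h0 | h0
      · have hz : ∑ i, ∑ t, V i t ^ 2 ≤ 0 := by simpa [← h0] using sum_sq_le_opNorm V
        have hVz : V = 0 := by
          ext i t
          have h5 := (Finset.sum_eq_zero_iff_of_nonneg fun i _ =>
            Finset.sum_nonneg fun t _ => sq_nonneg (V i t)).1 (le_antisymm hz
              (Finset.sum_nonneg fun i _ => Finset.sum_nonneg fun t _ => sq_nonneg (V i t)))
          have h6 := (Finset.sum_eq_zero_iff_of_nonneg fun t _ => sq_nonneg (V i t)).1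
            (h5 i (Finset.mem_univ i)) t (Finset.mem_univ t)
          exact pow_eq_zero_iff two_ne_zero |>.1 h6
        have herrz : err l' = 0 := by simp [herr, hVz]
        rw [herrz, mul_zero]
        positivity
      · simp only [hg] at h2
        rw [div_mul_eq_mul_div, div_le_one (by positivity)] at h2
        have h7 : 1 ≤ (ε * L) ^ 2 := one_le_pow₀ hεL'
        have h8 : (L ^ 2) ^ 2 * err l' ≤ (ε * L) ^ 2 * ((L ^ 2) ^ 2 * err l') :=
          le_mul_of_one_le_left (mul_nonneg (by positivity) (herr0 l')) h7
        have h9 := mul_le_mul_of_nonneg_left h2 (show 0 ≤ ε ^ 2 / 4 by positivity)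
        refine h8.trans (le_trans (le_of_eq ?_) h9)
        ring
  have hEf : expect (iid (PMF.uniformOfFintype (Fin n)) mD) f ≤ 0.01 := by
    simp only [hf]
    rw [expect_const_mul]
    have h1 := expect_card_badRows_le Q K M hn hε0 hθ (by positivity) hD
      (m := mD) (by exact_mod_cast hmD0)
    have h2 : 256 / ε ^ 2 + 16 * L ^ 2 * Real.log n / ε ^ 3 ≤
        L ^ 5 * (256 + 16 * Real.log n) := by
      have h3 : (1 / ε) ^ 2 ≤ L ^ 2 := pow_le_pow_left₀ (by positivity) hεL 2
      have h4 : (1 / ε) ^ 3 ≤ L ^ 3 := pow_le_pow_left₀ (by positivity) hεL 3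
      calc _ = 256 * (1 / ε) ^ 2 + 16 * L ^ 2 * Real.log n * (1 / ε) ^ 3 := by field_simp
        _ ≤ 256 * L ^ 2 + 16 * L ^ 2 * Real.log n * L ^ 3 := by gcongr
        _ ≤ 256 * L ^ 5 + 16 * L ^ 2 * Real.log n * L ^ 3 := by
          gcongr
          norm_num
        _ = _ := by ring
    calc _ ≤ 64 * L ^ 13 / n * (n / mD * (L ^ 5 * (256 + 16 * Real.log n)) * L) := by
          refine mul_le_mul_of_nonneg_left (h1.trans ?_) (by positivity)
          gcongr
      _ = 64 * L ^ 19 * (256 + 16 * Real.log n) / mD := by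
          field_simp
      _ ≤ 0.01 := by
          rw [div_le_iff₀ hmD0]
          have h5 : L ^ 19 * (6400 * (256 + 16 * Real.log n)) ≤ L ^ 20 * G := by
            gcongr
            norm_num
          linarith
  have hEg : expect (iid (weightedPMF (rowSq V)) mS) g ≤ 0.01 := by
    simp only [hg]
    rw [expect_const_mul]
    have h1 := expect_sampling_error_le X V (m := mS) (by exact_mod_cast hmS0)
    rcases hV0.eq_or_lt with h0 | h0
    · rw [← h0]
      norm_num
    calc _ ≤ 4 * L ^ 6 / opNorm V ^ 2 * (L * (d * opNorm V ^ 2) / mS) := by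
          refine mul_le_mul_of_nonneg_left (h1.trans ?_) (by positivity)
          gcongr
          · exact Finset.sum_nonneg fun i _ => rowSq_nonneg V i
          · exact sum_rowSq_le_opNorm V
      _ = 4 * L ^ 7 * d / mS := by
          field_simp
      _ ≤ 0.01 := by
          rw [div_le_iff₀ hmS0]
          have h5 : d * (L ^ 7 * 400) ≤ d * (L ^ 20 * G) := by
            gcongr
            · norm_num
            · linarith
          linarith
  have hpair : ((iid (PMF.uniformOfFintype (Fin n)) mD).bind fun l =>
        (iid (weightedPMF (rowSq V)) mS).map fun l' =>
          (rowSumEstimate Q K M 1 ε θ l, fun r => (l' r, sampleCoeff V mS (l' r)))) =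
      ((iid (PMF.uniformOfFintype (Fin n)) mD).bind fun l =>
        (iid (weightedPMF (rowSq V)) mS).map (Prod.mk l)).map fun p =>
          (rowSumEstimate Q K M 1 ε θ p.1, fun r => (p.2 r, sampleCoeff V mS (p.2 r))) := by
    simp only [PMF.map_bind, PMF.map_comp, Function.comp_def]
  rw [hpair, PMF.toOuterMeasure_map_apply, toOuterMeasure_eq_expect, expect_bind]
  simp only [expect_map]
  refine ENNReal.ofReal_le_ofReal (le_trans (by norm_num) (le_expect_indicator _ _
    (x := 0.01) (y := 0.01) hgood (fun l => ?_) (fun l' => ?_) hEf hEg))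
  · simp only [hf]
    positivity
  · exact mul_nonneg (by positivity) (herr0 l')

theorem le_run_toOuterMeasure_hyperAttention [NeZero n] (hn : 2 ≤ n) {κ ε L G : ℝ} (hL : 1 ≤ L)
    (hG : 6400 * (256 + 16 * Real.log n) ≤ G) (hκ0 : 0 < κ) (hκL : κ ≤ L) (hε0 : 0 < ε)
    (hε1 : ε ≤ 1) (hεL : 1 / ε ≤ L) (hcol : ∀ j, ∑ i, softmaxMatrix Q K i j ^ 2 ≤ L / n)
    (hu : ∀ i j, unmaskedRowSum Q K M i ≤ κ * unmaskedRowSum Q K M j) {mD mS : ℕ}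
    (hd : 0 < d) (hmD : L ^ 20 * G ≤ mD) (hmS : d * (L ^ 20 * G) ≤ mS) :
    ENNReal.ofReal 0.98 ≤
      (hyperAttention 1 Q K V M κ ε mD mS).run.toOuterMeasure
        {r | SpectralGuarantee Q K V ε r.1.1 (samplingMatrix r.1.2)} := by
  have hmD0 : 0 < mD := by
    have hlog : 0 < Real.log n := Real.log_pos (by exact_mod_cast hn)
    have hG0 : 0 < G := by linarith
    have : (0 : ℝ) < mD := lt_of_lt_of_le (by positivity) hmD
    exact_mod_cast this
  refine le_of_le_of_eq ?_ (run_toOuterMeasure (hyperAttention 1 Q K V M κ ε mD mS)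
    {r | SpectralGuarantee Q K V ε r.1 (samplingMatrix r.2)}).symm
  rw [val_hyperAttention]
  refine le_toOuterMeasure_bind _ _ _ _ fun T hT => ?_
  rw [PMF.mem_support_uniformOfFinset_iff, Finset.mem_powersetCard] at hT
  obtain ⟨j, hj⟩ : T.Nonempty := by
    rw [← Finset.card_pos, hT.2]
    exact lt_min hmD0 (by omega)
  have hu0 := unmaskedRowSum_nonneg Q K M
  have hτ := unmaskedRowSum_le_maxRowSum Q K M hj
  have hτ0 : 0 ≤ maxRowSum Q K M T := (hu0 j).trans hτ
  refine le_toOuterMeasure_spectralGuarantee Q K V M hn hL hG hε0 hε1 hεL hcol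
    (fun i => ?_) (fun i => ?_) hd hmD hmS
  · rw [div_le_iff₀' hκ0]
    exact maxRowSum_le Q K M (mul_nonneg hκ0.le (hu0 i)) fun j => hu j i
  · rw [← maskedRowSum_add_unmaskedRowSum Q K M i, mul_add]
    refine add_le_add
      (le_mul_of_one_le_left (maskedRowSum_nonneg Q K M i) (one_le_pow₀ hL)) ?_
    calc unmaskedRowSum Q K M i ≤ κ * maxRowSum Q K M T :=
          (hu i j).trans (mul_le_mul_of_nonneg_left hτ hκ0.le)
      _ = κ ^ 2 * (maxRowSum Q K M T / κ) := by field_simp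
      _ ≤ _ := by gcongr

end success

/-! ### The choice of the parameters -/

theorem eventually_log_le_exp_sqrt_log : ∀ᶠ n : ℕ in atTop,
    6400 * (256 + 16 * Real.log n) ≤ Real.exp (√(Real.log n)) := by
  have hsqrt : Tendsto (fun n : ℕ => √(Real.log n)) atTop atTop :=
    Real.tendsto_sqrt_atTop.comp (Real.tendsto_log_atTop.comp tendsto_natCast_atTop_atTop)
  filter_upwards [hsqrt.eventually ((Real.tendsto_exp_div_pow_atTop 2).eventually_ge_atTop
    (6400 * 272)), hsqrt.eventually_ge_atTop 1, eventually_ge_atTop 1] with n h1 h2 hn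
  have hlog : 0 ≤ Real.log n := Real.log_nonneg (by exact_mod_cast hn)
  rw [le_div_iff₀ (by positivity)] at h1
  have h3 := one_le_pow₀ h2 (n := 2)
  rw [Real.sq_sqrt hlog] at h1 h3
  linarith

theorem rpow_add_inv_sqrt_log {n : ℕ} (hn : 2 ≤ n) (x : ℝ) :
    (n : ℝ) ^ (20 * x + (√(Real.log n))⁻¹) = ((n : ℝ) ^ x) ^ 20 * Real.exp (√(Real.log n)) := by
  have hn0 : (0 : ℝ) < n := by positivity
  have hlog : 0 < Real.log n := Real.log_pos (by exact_mod_cast hn)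
  rw [Real.rpow_add hn0, mul_comm (20 : ℝ) x, Real.rpow_mul hn0.le]
  congr 1
  · exact_mod_cast Real.rpow_natCast _ 20
  · rw [Real.rpow_def_of_pos hn0, ← div_eq_mul_inv, Real.div_sqrt]

theorem ceil_mul_rpow_le {n : ℕ} (hn : 1 ≤ n) {x s t : ℝ} (hx : 1 ≤ x) (ht : 0 ≤ t)
    (hst : s ≤ t) : (⌈x * (n : ℝ) ^ s⌉₊ : ℝ) ≤ 2 * (x * (n : ℝ) ^ t) := by
  have hn1 : (1 : ℝ) ≤ n := by exact_mod_cast hn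
  have h1 : (n : ℝ) ^ s ≤ (n : ℝ) ^ t := Real.rpow_le_rpow_of_exponent_le hn1 hst
  have h2 : 1 ≤ (n : ℝ) ^ t := Real.one_le_rpow hn1 ht
  have h3 := (Nat.ceil_lt_add_one (show 0 ≤ x * (n : ℝ) ^ s by positivity)).le
  have h4 : x * (n : ℝ) ^ s ≤ x * (n : ℝ) ^ t := by gcongr
  have h5 : 1 ≤ x * (n : ℝ) ^ t := one_le_mul_of_one_le_of_one_le hx h2
  linarith

/-- The number of steps of `HyperAttention` is almost linear in `n`. -/
theorem steps_hyperAttention_le {n d : ℕ} [NeZero n] (c κ ε : ℝ)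
    (Q K V : Matrix (Fin n) (Fin d) ℝ) (M : Matrix (Fin n) (Fin n) Bool) (hd : 0 < d) {s δ : ℝ}
    {mD mS : ℕ} (hmD : mD = ⌈d * (n : ℝ) ^ s⌉₊ ∨ mD = ⌈(n : ℝ) ^ s⌉₊)
    (hmS : mS = ⌈d * (n : ℝ) ^ s⌉₊) (h : (d : ℝ) ≤ (n : ℝ) ^ δ ∨ mD = ⌈(n : ℝ) ^ s⌉₊)
    (r : ((Fin n → ℝ) × (Fin mS → Fin n × ℝ)) × ℕ)
    (hr : r ∈ (hyperAttention c Q K V M κ ε mD mS).run.support) :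
    (r.2 : ℝ) ≤ 500 * (d * (n : ℝ) ^ (1 + (|s| + |δ|)) + d * nnz M) := by
  have hn : 1 ≤ n := Nat.pos_of_ne_zero (NeZero.ne n)
  have hn1 : (1 : ℝ) ≤ n := by exact_mod_cast hn
  have hn0 : (0 : ℝ) < n := by linarith
  have hd1 : (1 : ℝ) ≤ d := by exact_mod_cast hd
  set t := |s| + |δ| with ht
  have hsδ : s + δ ≤ t := add_le_add (le_abs_self s) (le_abs_self δ)
  have hst : s ≤ t := (le_abs_self s).trans (le_add_of_nonneg_right (abs_nonneg δ))
  have ht0 : 0 ≤ t := by positivity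
  have h1 : 1 ≤ (n : ℝ) ^ t := Real.one_le_rpow hn1 ht0
  have hS : (mS : ℝ) ≤ 2 * (d * (n : ℝ) ^ t) := by
    rw [hmS]
    exact ceil_mul_rpow_le hn hd1 ht0 hst
  have hunif : (⌈(n : ℝ) ^ s⌉₊ : ℝ) ≤ 2 * (n : ℝ) ^ t := by
    simpa using ceil_mul_rpow_le hn le_rfl ht0 hst
  have hD : (mD : ℝ) ≤ 2 * (n : ℝ) ^ t := by
    rcases h with h | h
    · rcases hmD with hmD | hmD
      · rw [hmD]
        have h2 : ⌈(d : ℝ) * (n : ℝ) ^ s⌉₊ ≤ ⌈1 * (n : ℝ) ^ (s + δ)⌉₊ := by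
          refine Nat.ceil_le_ceil ?_
          rw [one_mul, Real.rpow_add hn0, mul_comm]
          gcongr
        refine (Nat.cast_le.2 h2).trans ?_
        simpa using ceil_mul_rpow_le hn le_rfl ht0 hsδ
      · rwa [hmD]
    · rwa [h]
  have hpos : 0 < (n : ℝ) ^ s := by positivity
  have hD0 : 0 < mD := by
    rcases hmD with hmD | hmD <;> rw [hmD] <;> exact Nat.ceil_pos.2 (by positivity)
  have hS0 : 0 < mS := by
    rw [hmS]
    exact Nat.ceil_pos.2 (by positivity)
  have hcost := costLE_hyperAttention Q K V M c κ ε mD mS hd hD0 hS0 r hr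
  have hcost' : (r.2 : ℝ) ≤ 100 * (d * n * mD + n * mS + d * n + d * nnz M) := by
    exact_mod_cast hcost
  rw [Real.rpow_add hn0, Real.rpow_one]
  have hdn : (0 : ℝ) ≤ d * n := by positivity
  have h3 := mul_le_mul_of_nonneg_left hD hdn
  have h4 := mul_le_mul_of_nonneg_left hS hn0.le
  have h5 := mul_le_mul_of_nonneg_left h1 hdn
  have h6 : (0 : ℝ) ≤ d * nnz M := by positivity
  linarith

end HyperAttention

open HyperAttention in
theorem mainTheorem1 :
    ∃ c : ℝ, 0 < c ∧ ∃ C : ℝ, 0 < C ∧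
    ∀ e a k : ℕ → ℝ, Tendsto e atTop (𝓝 0) → Tendsto a atTop (𝓝 0) → Tendsto k atTop (𝓝 0) →
    ∃ s : ℕ → ℝ, Tendsto s atTop (𝓝 0) ∧
    ∀ δ : ℕ → ℝ, Tendsto δ atTop (𝓝 0) →
    ∃ t : ℕ → ℝ, Tendsto t atTop (𝓝 0) ∧
    ∃ N : ℕ, ∀ (n : ℕ) [NeZero n], N ≤ n →
    ∀ (d : ℕ), 0 < d →
    ∀ (Q K V : Matrix (Fin n) (Fin d) ℝ) (M : Matrix (Fin n) (Fin n) Bool) (ε : ℝ),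
      1 / (n : ℝ) ^ e n < ε → ε ≤ 1 →
      (∀ j, ∑ i, softmaxMatrix Q K i j ^ 2 ≤ (n : ℝ) ^ a n / n) →
      (∀ i j, unmaskedRowSum Q K M i ≤ (n : ℝ) ^ k n * unmaskedRowSum Q K M j) →
      ∀ mD mS : ℕ, (mD = ⌈d * (n : ℝ) ^ s n⌉₊ ∨ mD = ⌈(n : ℝ) ^ s n⌉₊) →
        mS = ⌈d * (n : ℝ) ^ s n⌉₊ →
        ENNReal.ofReal 0.98 ≤
          (hyperAttention c Q K V M ((n : ℝ) ^ k n) ε mD mS).run.toOuterMeasure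
            {r | SpectralGuarantee Q K V ε r.1.1 (samplingMatrix r.1.2)} ∧
        ((d : ℝ) ≤ (n : ℝ) ^ δ n ∨ mD = ⌈(n : ℝ) ^ s n⌉₊ →
          ∀ r ∈ (hyperAttention c Q K V M ((n : ℝ) ^ k n) ε mD mS).run.support,
            (r.2 : ℝ) ≤ C * (d * (n : ℝ) ^ (1 + t n) + d * nnz M)) := by
  refine ⟨1, one_pos, 500, by norm_num, fun e a k he ha hk => ?_⟩
  set x : ℕ → ℝ := fun n => |e n| + |a n| + |k n| with hx
  set s : ℕ → ℝ := fun n => 20 * x n + (√(Real.log n))⁻¹ with hs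
  have hs0 : Tendsto s atTop (𝓝 0) := by
    have h1 : Tendsto (fun n : ℕ => (√(Real.log n))⁻¹) atTop (𝓝 0) :=
      tendsto_inv_atTop_zero.comp (Real.tendsto_sqrt_atTop.comp
        (Real.tendsto_log_atTop.comp tendsto_natCast_atTop_atTop))
    simpa using (((he.abs.add ha.abs).add hk.abs).const_mul 20).add h1
  refine ⟨s, hs0, fun δ hδ => ⟨fun n => |s n| + |δ n|, by simpa using hs0.abs.add hδ.abs, ?_⟩⟩
  obtain ⟨N, hN⟩ := eventually_atTop.1 eventually_log_le_exp_sqrt_log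
  refine ⟨max N 2, fun n _ hn d hd Q K V M ε hε hε1 hcol hu mD mS hmD hmS => ⟨?_, fun h r hr =>
    steps_hyperAttention_le 1 _ ε Q K V M hd hmD hmS h r hr⟩⟩
  have hn2 : 2 ≤ n := (le_max_right _ _).trans hn
  have hn1 : (1 : ℝ) ≤ n := by exact_mod_cast (by omega : 1 ≤ n)
  have hn0 : (0 : ℝ) < n := by linarith
  have hd1 : (1 : ℝ) ≤ d := by exact_mod_cast hd
  have hpow {y : ℝ} (hy : y ≤ x n) : (n : ℝ) ^ y ≤ (n : ℝ) ^ x n :=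
    Real.rpow_le_rpow_of_exponent_le hn1 hy
  have hex : e n ≤ x n := by
    linarith [le_abs_self (e n), abs_nonneg (a n), abs_nonneg (k n)]
  have hax : a n ≤ x n := by
    linarith [le_abs_self (a n), abs_nonneg (e n), abs_nonneg (k n)]
  have hkx : k n ≤ x n := by
    linarith [le_abs_self (k n), abs_nonneg (a n), abs_nonneg (e n)]
  have hε0 : 0 < ε := lt_trans (by positivity) hε
  have hsn : (n : ℝ) ^ s n = ((n : ℝ) ^ x n) ^ 20 * Real.exp (√(Real.log n)) :=
    rpow_add_inv_sqrt_log hn2 (x n)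
  refine le_run_toOuterMeasure_hyperAttention Q K V M hn2 (L := (n : ℝ) ^ x n)
    (Real.one_le_rpow hn1 (by positivity)) (hN n ((le_max_left _ _).trans hn)) (by positivity)
    (hpow hkx) hε0 hε1 ?_ (fun j => (hcol j).trans ?_) hu hd ?_ ?_
  · refine le_trans ?_ (hpow hex)
    rw [div_lt_iff₀ (by positivity)] at hε
    rw [div_le_iff₀' hε0]
    exact hε.le
  · gcongr
  · rw [← hsn]
    rcases hmD with h | h <;> rw [h]
    · exact (le_mul_of_one_le_left (by positivity) hd1).trans (Nat.le_ceil _)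
    · exact Nat.le_ceil _
  · rw [← hsn, hmS]
    exact Nat.le_ceil _
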